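/- **Setting.** An instance of $k$-RB consists of $n$ arms, an integer $1\le k<n$, and for each arm $i$ a non-decreasing payoff function $p_i:\{1,2,\dots\}\to[0,1]$ with a recovery time $\tau_i^{\max}\ge 1$, i.e. $p_i(\tau)=p_i(\tau_i^{\max})$ for all $\tau\ge\tau_i^{\max}$; further, an integer $\tau^{\max}\ge\max_i\tau_i^{\max}$ is given. In each round $t=1,2,\dots$ a set of at most $k$ arms is played, and playing arm $i$ yields $p_i(\tau)$, where the delay $\tau$ is the number of rounds since the last play of $i$ (all arms count as played at time $0$). Let $\mathrm{OPT}(T)$ be the maximum total payoff that can be collected in rounds $1,\dots,T$. Consider the linear program: maximize $\sum_i\sum_{\tau\ge1}p_i(\tau)x_{i,\tau}$ over $x\ge0$ subject to $\sum_i\sum_{\tau\ge 1} x_{i,\tau}\le k$ and $\sum_{\tau\ge 1}\tau x_{i,\tau}\le1$ for every arm $i$. **Algorithm (Randomize-Then-Interleave).** Let $x^*$ be an optimal extreme point solution of the linear program; an arm $i$ is supported if $x^*_{i,\tau}>0$ for some $\tau$. For each supported arm $i$, except for at most one irregular arm $\iota$, let $\tau^*_i$ be the unique $\tau$ with $x^*_{i,\tau}=1/\tau$.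 If there is an irregular arm $\iota$, its only non-zero variables are among $x^*_{\iota,a},x^*_{\iota,b}$ for some $a\neq b$, where $0<x^*_{\iota,a}<1/a$ and $0\le x^*_{\iota,b}<1/b$; sample $\tau^*_\iota\in\{a,b,\infty\}$ with probabilities $a x^*_{\iota,a}$, $b x^*_{\iota,b}$ and $1-a x^*_{\iota,a}-b x^*_{\iota,b}$, and discard $\iota$ if $\tau^*_\iota=\infty$. Then draw for each remaining supported arm $i$ an offset $r_i$ independently and uniformly from $\{0,\dots,\tau^*_i-1\}$. In each round $t=1,2,\dots$ play a set of at most $k$ arms, among the candidates $i$ with $t\bmod\tau^*_i=r_i$, that maximizes the total payoff under the actual current delays (ties are broken arbitrarily). **Theorem.** For every instance of $k$-RB the linear program has an optimal extreme point solution, and from every such solution the algorithm can be carried out. There is an absolute constant $C$ such that, for every instance of $k$-RB, every optimal extreme point solution $x^*$, every tie-breaking, and every $T\ge 0$, the expected total payoff collected by the algorithm in $T$ rounds is at least $$\left(1-\frac{k^k}{e^k\,k!}\right)\mathrm{OPT}(T)-C\,k\,\tau^{\max}.$$ Here $\frac{k^k}{e^k k!}\sim\frac1{\sqrt{2\pi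 k}}$ as $k\to\infty$. For $k=1$ the algorithm is a long-run $(1-1/e)$-approximation: for every instance and every $\varepsilon>0$, for all sufficiently large $T$, the expected total payoff in $T$ rounds is at least $(1-1/e-\varepsilon)\,\mathrm{OPT}(T)$. -/

import Mathlib

open Filter Asymptotics
open scoped BigOperators Nat

noncomputable section

/-- A planning instance with arms `Fin n`, at most `k` of which can be played per round.
Delays are positive integers. -/
structure RBInstance (n k : ℕ) where
  one_le_k : 1 ≤ k
  k_lt_n : k < n
  /-- `p i τ` is the (mean) payoff of arm `i` when played under delay `τ`. -/
  p : Fin n → ℕ+ → ℝ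
  p_nonneg : ∀ i τ, 0 ≤ p i τ
  p_le_one : ∀ i τ, p i τ ≤ 1
  p_mono : ∀ i, Monotone (p i)
  /-- The recovery time of each arm. -/
  recovery : Fin n → ℕ+
  p_recovery : ∀ i τ, recovery i ≤ τ → p i τ = p i (recovery i)
  /-- A universal upper bound on the recovery times. -/
  tauMax : ℕ+
  recovery_le : ∀ i, recovery i ≤ tauMax

/-- The set of arms played at each round; the rounds are `t = 1, 2, …`
(the value at `0` plays no role). -/
abbrev Schedule (n : ℕ) := ℕ → Finset (Fin n)

open Classical in
/-- The delay of arm `i` at round `t` under `A`: the number of rounds since its last play before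
round `t`, where every arm counts as played at time `0`. The value at `t = 0` is irrelevant. -/
def delay {n : ℕ} (A : Schedule n) (i : Fin n) : ℕ → ℕ+
  | 0 => 1
  | t + 1 => if t = 0 ∨ i ∈ A t then 1 else delay A i t + 1

namespace RBInstance

variable {n k : ℕ} (I : RBInstance n k)

/-- Payoff collected by the schedule `A` in rounds `1, …, T`. -/
def totalPayoff (A : Schedule n) (T : ℕ) : ℝ :=
  ∑ t ∈ Finset.Icc 1 T, ∑ i ∈ A t, I.p i (delay A i t)

/-- The optimal payoff in `T` rounds: supremum over all schedules playing at most `k` arms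
per round. -/
def opt (T : ℕ) : ℝ :=
  sSup {v : ℝ | ∃ A : Schedule n, (∀ t, (A t).card ≤ k) ∧ v = I.totalPayoff A T}

/-! The linear programming relaxation, with variables `x i τ`. -/

/-- The feasible region of the LP. -/
def feasible (_I : RBInstance n k) : Set (Fin n → ℕ+ → ℝ) :=
  {x | (∀ i τ, 0 ≤ x i τ) ∧
       (∀ i, Summable (fun τ : ℕ+ => ((τ : ℕ) : ℝ) * x i τ)) ∧
       ∑ i, ∑' τ : ℕ+, x i τ ≤ (k : ℝ) ∧
       ∀ i, ∑' τ : ℕ+, ((τ : ℕ) : ℝ) * x i τ ≤ 1}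

/-- The objective of the LP. -/
def lpValue (x : Fin n → ℕ+ → ℝ) : ℝ :=
  ∑ i, ∑' τ : ℕ+, I.p i τ * x i τ

/-- `x` is an optimal extreme point solution of the LP. -/
def IsOptimalExtremePoint (x : Fin n → ℕ+ → ℝ) : Prop :=
  x ∈ Set.extremePoints ℝ I.feasible ∧ ∀ y ∈ I.feasible, I.lpValue y ≤ I.lpValue x

end RBInstance

/-- Arm `i` is supported in `x`. -/
def Supported {n : ℕ} (x : Fin n → ℕ+ → ℝ) (i : Fin n) : Prop :=
  ∃ τ, 0 < x i τ

open Classical in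
/-- The candidate arms at round `t`, for critical delays `c` (`none` stands for `∞`, i.e. an arm
that is not or no longer supported) and offsets `r`. -/
def candidates {n : ℕ} (c : Fin n → Option ℕ+) (r : Fin n → ℕ) (t : ℕ) : Finset (Fin n) :=
  Finset.univ.filter fun i => ∃ d : ℕ+, c i = some d ∧ t % (d : ℕ) = r i

/-- The possible offset vectors for critical delays `c`: `r i` ranges over `{0, …, c i - 1}`
(arms without a critical delay get the dummy offset `0`). -/
def offsets {n : ℕ} (c : Fin n → Option ℕ+) : Finset (Fin n → ℕ) :=
  Fintype.piFinset fun i => Finset.range ((c i).elim 1 fun d => (d : ℕ))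

namespace RBInstance

variable {n k : ℕ} (I : RBInstance n k)

/-- The online phase: at each round `t ≥ 1` the schedule `A` plays a set of at most `k` candidates
of maximum total payoff, with respect to the actual delays. Ties are broken arbitrarily. -/
def IsOnlineRun (c : Fin n → Option ℕ+) (r : Fin n → ℕ) (A : Schedule n) : Prop :=
  ∀ t, 1 ≤ t →
    A t ⊆ candidates c r t ∧ (A t).card ≤ k ∧
    ∀ S ⊆ candidates c r t, S.card ≤ k →
      ∑ i ∈ S, I.p i (delay A i t) ≤ ∑ i ∈ A t, I.p i (delay A i t)

/-- An implementation of Randomize-Then-Interleave started from the LP solution `x`: the choices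
which the algorithm makes deterministically (irregular arm, critical delays, tie-breaking). -/
structure RandomizeThenInterleave (x : Fin n → ℕ+ → ℝ) where
  /-- The irregular arm, if there is one. -/
  irregular : Option (Fin n)
  /-- The critical delays of the supported arms other than the irregular one. -/
  critical : Fin n → ℕ+
  /-- The first potential critical delay of the irregular arm. -/
  a : ℕ+
  /-- The second potential critical delay of the irregular arm. -/
  b : ℕ+
  critical_spec : ∀ i, Supported x i → irregular ≠ some i →
    x i (critical i) = 1 / ((critical i : ℕ) : ℝ)
  irregular_spec : ∀ i, irregular = some i →
    0 < x i a ∧ 0 ≤ x i b ∧ a ≠ b ∧ (∀ τ, x i τ ≠ 0 → τ = a ∨ τ = b) ∧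
    x i a < 1 / ((a : ℕ) : ℝ) ∧ x i b < 1 / ((b : ℕ) : ℝ)
  /-- The schedule played in the online phase for given critical delays and offsets. -/
  play : (Fin n → Option ℕ+) → (Fin n → ℕ) → Schedule n
  play_spec : ∀ c r, I.IsOnlineRun c r (play c r)

namespace RandomizeThenInterleave

variable {I} {x : Fin n → ℕ+ → ℝ} (E : I.RandomizeThenInterleave x)

open Classical in
/-- The vector of critical delays when `s` is the one sampled for the irregular arm
(`none` stands for `∞`). -/
def criticalDelays (s : Option ℕ+) : Fin n → Option ℕ+ := fun i =>
  if E.irregular = some i then s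
  else if Supported x i then some (E.critical i) else none

/-- Expected payoff in `T` rounds over independent uniform offsets, given the critical delay `s`
sampled for the irregular arm. -/
def offsetMean (s : Option ℕ+) (T : ℕ) : ℝ :=
  𝔼 r ∈ offsets (E.criticalDelays s), I.totalPayoff (E.play (E.criticalDelays s) r) T

/-- Expected total payoff in `T` rounds: the critical delay of the irregular arm `ι` (if any) is
`a`, `b`, `∞` with probabilities `a * x ι a`, `b * x ι b` and the remaining one, respectively. -/
def expectedPayoff (T : ℕ) : ℝ :=
  match E.irregular with
  | none => E.offsetMean none T
  | some i =>
      ((E.a : ℕ) : ℝ) * x i E.a * E.offsetMean (some E.a) T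
      + ((E.b : ℕ) : ℝ) * x i E.b * E.offsetMean (some E.b) T
      + (1 - ((E.a : ℕ) : ℝ) * x i E.a - ((E.b : ℕ) : ℝ) * x i E.b) * E.offsetMean none T

end RandomizeThenInterleave

end RBInstance

end

/-!
The proof compares both the optimum and the algorithm with `T` times the value of the LP.

*Upper bound.* The frequencies with which a schedule plays each arm under each delay are a feasible
LP solution: the delays of the plays of an arm within `T` rounds add up to at most `T`. Hence
`OPT(T) ≤ T · LP` (`RBInstance.opt_le`).

*Lower bound.* From round `tauMax` on, a candidate always yields at least the payoff of its critical
delay (`RBInstance.p_le_p_delay`), so a round yields at least the sum of the `k` largest such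
payoffs among the candidates. Writing payoffs in `[0, 1]` as integrals over thresholds `θ`, that
sum is at least `∫ min(k, N_θ) dθ`, where `N_θ` counts the candidates whose critical delay has
payoff at least `θ` (`exists_integral_min_le_sum`). In a fixed round an arm `i` is a candidate with
critical delay `τ` with probability exactly `x i τ`, and different arms are independent. The two
alternatives of the irregular arm exclude each other, so at each single threshold this arm is again
one Bernoulli variable, and `N_θ` is a sum of independent Bernoulli variables whose total mean `μ`
is at most `k` (`RBInstance.RandomizeThenInterleave.mul_sum_hitProb_le`).

For such a sum, `E min(k, N) ≥ (1 - k^k / (e^k k!)) μ` (`le_bernoulliMean_min`). Indeed, replacing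
the Bernoulli variables one at a time by a Poisson variable of the same mean only increases the
deficit `E (k - N)⁺`, as its Poisson value is convex in the mean and each Bernoulli variable moves
along a tangent. The Poisson value of `E min(k, N)` is concave in `μ`, vanishes at `μ = 0`, and
gives the constant at `μ = k`. Integrating over `θ` gives `1 - k^k / (e^k k!)` times the LP value
in each round from `tauMax` on; an earlier round loses at most `k`.

*The LP.* Weight beyond `tauMax` can be moved to `tauMax`, so the optimum is attained on a compact
face of the feasible region, and an extreme point of the optimal set in this face is extreme in the
whole region. An extreme point admits no perturbation within its support that keeps the total weight
and the tight arm constraints (`RBInstance.direction_eq_zero`), and counting the degrees of freedom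
leaves at most one irregular arm with at most two positive variables.
-/

/-! ### Poisson tails -/

/-- The probability `e^{-μ} μ^j / j!` that a Poisson variable of mean `μ` equals `j`. -/
noncomputable def poissonWeight (j : ℕ) (μ : ℝ) : ℝ := Real.exp (-μ) * (μ ^ j / (j ! : ℝ))

/-- The probability that a Poisson variable of mean `μ` is less than `k`. -/
noncomputable def poissonBelow (k : ℕ) (μ : ℝ) : ℝ := ∑ j ∈ Finset.range k, poissonWeight j μ

/-- The expected deficit `E (k - X)⁺` of a Poisson variable `X` of mean `μ`, written through
`(k - X)⁺ = ∑_{m < k} 1[X ≤ m]`. -/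
noncomputable def poissonDeficit (k : ℕ) (μ : ℝ) : ℝ :=
  ∑ m ∈ Finset.range k, poissonBelow (m + 1) μ

theorem poissonWeight_nonneg (j : ℕ) {μ : ℝ} (hμ : 0 ≤ μ) : 0 ≤ poissonWeight j μ := by
  unfold poissonWeight; positivity

theorem mul_poissonWeight (j : ℕ) (μ : ℝ) :
    μ * poissonWeight j μ = (j + 1) * poissonWeight (j + 1) μ := by
  unfold poissonWeight
  have h : (j ! : ℝ) ≠ 0 := by positivity
  have h' : (j + 1 : ℝ) ≠ 0 := by positivity
  rw [Nat.factorial_succ]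
  push_cast
  field_simp
  ring

theorem hasDerivAt_poissonWeight_zero (μ : ℝ) :
    HasDerivAt (poissonWeight 0) (-poissonWeight 0 μ) μ := by
  have h : HasDerivAt (fun μ : ℝ => Real.exp (-μ)) (Real.exp (-μ) * (-1)) μ :=
    (hasDerivAt_neg μ).exp
  have e : poissonWeight 0 = fun μ : ℝ => Real.exp (-μ) := by
    funext μ; simp [poissonWeight]
  rw [e]
  simpa using h

theorem hasDerivAt_poissonWeight_succ (j : ℕ) (μ : ℝ) :
    HasDerivAt (poissonWeight (j + 1)) (poissonWeight j μ - poissonWeight (j + 1) μ) μ := by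
  have h : HasDerivAt (fun μ : ℝ => Real.exp (-μ)) (Real.exp (-μ) * (-1)) μ :=
    (hasDerivAt_neg μ).exp
  have h2 := h.mul ((hasDerivAt_pow (j + 1) μ).div_const ((j + 1)! : ℝ))
  refine h2.congr_deriv ?_
  have hj : (j ! : ℝ) ≠ 0 := by positivity
  have h' : (j + 1 : ℝ) ≠ 0 := by positivity
  simp only [poissonWeight, Nat.factorial_succ, Nat.add_sub_cancel]
  push_cast
  field_simp
  ring

theorem hasDerivAt_poissonBelow_succ (k : ℕ) (μ : ℝ) :
    HasDerivAt (poissonBelow (k + 1)) (-poissonWeight k μ) μ := by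
  induction k with
  | zero =>
    have e : poissonBelow 1 = poissonWeight 0 := by funext μ; simp [poissonBelow]
    simpa [e] using hasDerivAt_poissonWeight_zero μ
  | succ k ih =>
    have e : poissonBelow (k + 2) = poissonBelow (k + 1) + poissonWeight (k + 1) := by
      funext μ; simp [poissonBelow, Finset.sum_range_succ]
    rw [e]
    refine (ih.add (hasDerivAt_poissonWeight_succ k μ)).congr_deriv ?_
    ring

theorem hasDerivAt_poissonDeficit (k : ℕ) (μ : ℝ) :
    HasDerivAt (poissonDeficit k) (-poissonBelow k μ) μ := by
  have e : poissonDeficit k = ∑ m ∈ Finset.range k, poissonBelow (m + 1) := by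
    funext μ; simp [poissonDeficit]
  rw [e, poissonBelow, ← Finset.sum_neg_distrib]
  exact HasDerivAt.sum fun m _ => hasDerivAt_poissonBelow_succ m μ

theorem poissonDeficit_succ (k : ℕ) (μ : ℝ) :
    poissonDeficit (k + 1) μ = poissonDeficit k μ + poissonBelow (k + 1) μ :=
  Finset.sum_range_succ _ _

theorem poissonBelow_antitoneOn (k : ℕ) : AntitoneOn (poissonBelow k) (Set.Ici 0) := by
  cases k with
  | zero => intro a _ b _ _; simp [poissonBelow]
  | succ k =>
    refine antitoneOn_of_deriv_nonpos (convex_Ici 0)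
      (fun μ _ => (hasDerivAt_poissonBelow_succ k μ).continuousAt.continuousWithinAt)
      (fun μ _ => (hasDerivAt_poissonBelow_succ k μ).differentiableAt.differentiableWithinAt)
      fun μ hμ => ?_
    rw [interior_Ici] at hμ
    rw [(hasDerivAt_poissonBelow_succ k μ).deriv]
    exact neg_nonpos.2 (poissonWeight_nonneg k (le_of_lt hμ))

theorem poissonDeficit_convexOn (k : ℕ) : ConvexOn ℝ (Set.Ici 0) (poissonDeficit k) := by
  refine MonotoneOn.convexOn_of_deriv (convex_Ici 0)
    (fun μ _ => (hasDerivAt_poissonDeficit k μ).continuousAt.continuousWithinAt)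
    (fun μ _ => (hasDerivAt_poissonDeficit k μ).differentiableAt.differentiableWithinAt) ?_
  rw [interior_Ici]
  intro a ha b hb hab
  rw [(hasDerivAt_poissonDeficit k a).deriv, (hasDerivAt_poissonDeficit k b).deriv]
  exact neg_le_neg (poissonBelow_antitoneOn k (Set.mem_Ici.2 (le_of_lt ha))
    (Set.mem_Ici.2 (le_of_lt hb)) hab)

/-- The graph of the Poisson deficit lies above its tangents. -/
theorem poissonDeficit_tangent_le (k : ℕ) {μ q : ℝ} (hμ : 0 ≤ μ) (hq : 0 ≤ q) :
    poissonDeficit k μ - q * poissonBelow k μ ≤ poissonDeficit k (μ + q) := by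
  rcases hq.eq_or_lt with rfl | hq
  · simp
  have h := (poissonDeficit_convexOn k).le_slope_of_hasDerivAt (x := μ) (y := μ + q)
    hμ (add_nonneg hμ hq.le) (by linarith) (hasDerivAt_poissonDeficit k μ)
  rw [slope_def_field, le_div_iff₀ (by linarith)] at h
  linarith

theorem poissonDeficit_eq (k : ℕ) (μ : ℝ) :
    poissonDeficit k μ = (k - μ) * poissonBelow k μ + k * poissonWeight k μ := by
  induction k with
  | zero => simp [poissonDeficit, poissonBelow]
  | succ k ih =>
    have e : poissonBelow (k + 1) μ = poissonBelow k μ + poissonWeight k μ :=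
      Finset.sum_range_succ _ _
    rw [poissonDeficit_succ, ih, e]
    push_cast
    linear_combination mul_poissonWeight k μ

theorem poissonWeight_self (k : ℕ) :
    poissonWeight k k = (k : ℝ) ^ k / (Real.exp 1 ^ k * (k ! : ℝ)) := by
  rw [poissonWeight, Real.exp_neg, ← Real.exp_nat_mul, mul_one]
  have h : (k ! : ℝ) ≠ 0 := by positivity
  field_simp

/-- A Poisson variable `X` of mean `μ ≤ k` has `E (min k X) ≥ (1 - k^k / (e^k k!)) μ`: the left
side is concave in `μ`, vanishes at `0`, and attains equality at `μ = k`. -/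
theorem mul_le_sub_poissonDeficit {k : ℕ} (hk : 1 ≤ k) {μ : ℝ} (hμ : 0 ≤ μ) (hμk : μ ≤ k) :
    (1 - poissonWeight k k) * μ ≤ k - poissonDeficit k μ := by
  have hk' : (0 : ℝ) < k := by exact_mod_cast hk
  have h0 : poissonDeficit k 0 = k := by
    have h : ∀ m, poissonBelow (m + 1) 0 = 1 := by
      intro m
      simp [poissonBelow, poissonWeight, Finset.sum_range_succ']
    simp [poissonDeficit, h]
  have h1 : poissonDeficit k k = k * poissonWeight k k := by
    simp [poissonDeficit_eq]
  have h := (poissonDeficit_convexOn k).2 (Set.mem_Ici.2 le_rfl) (Set.mem_Ici.2 hk'.le)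
    (show 0 ≤ 1 - μ / k by rw [sub_nonneg, div_le_one hk']; exact hμk)
    (show 0 ≤ μ / k by positivity) (by ring)
  simp only [smul_eq_mul, mul_zero, zero_add, h0, h1] at h
  have e : μ / k * k = μ := by field_simp
  have e2 : μ / k * (k * poissonWeight k k) = μ * poissonWeight k k := by
    rw [← mul_assoc, e]
  rw [e, e2, sub_mul, e] at h
  linarith

/-! ### Sums of independent Bernoulli variables -/

/-- The expectation of `F W` when `W ⊆ S` contains each `i ∈ S` independently with
probability `q i`. -/
def bernoulliMean {ι : Type*} [DecidableEq ι] (S : Finset ι) (q : ι → ℝ) (F : Finset ι → ℝ) : ℝ :=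
  ∑ W ∈ S.powerset, (∏ i ∈ S, if i ∈ W then q i else 1 - q i) * F W

section

variable {ι : Type*} [DecidableEq ι]

theorem bernoulliMean_congr {S : Finset ι} {q q' : ι → ℝ} {F F' : Finset ι → ℝ}
    (hq : ∀ i ∈ S, q i = q' i) (hF : ∀ W ⊆ S, F W = F' W) :
    bernoulliMean S q F = bernoulliMean S q' F' := by
  refine Finset.sum_congr rfl fun W hW => ?_
  rw [hF W (Finset.mem_powerset.1 hW)]
  congr 1
  exact Finset.prod_congr rfl fun i hi => by rw [hq i hi]

theorem bernoulliMean_insert {S : Finset ι} {a : ι} (ha : a ∉ S) (q : ι → ℝ)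
    (F : Finset ι → ℝ) :
    bernoulliMean (insert a S) q F =
      (1 - q a) * bernoulliMean S q F + q a * bernoulliMean S q (fun W => F (insert a W)) := by
  unfold bernoulliMean
  rw [Finset.sum_powerset_insert ha, Finset.mul_sum, Finset.mul_sum]
  congr 1
  · refine Finset.sum_congr rfl fun W hW => ?_
    have haW : a ∉ W := fun h => ha (Finset.mem_powerset.1 hW h)
    rw [Finset.prod_insert ha, if_neg haW, mul_assoc]
  · refine Finset.sum_congr rfl fun W hW => ?_
    rw [Finset.prod_insert ha, if_pos (Finset.mem_insert_self _ _), mul_assoc]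
    congr 2
    refine Finset.prod_congr rfl fun i hi => ?_
    have hia : i ≠ a := fun h => ha (h ▸ hi)
    simp [hia]

theorem bernoulliMean_const (S : Finset ι) (q : ι → ℝ) (c : ℝ) :
    bernoulliMean S q (fun _ => c) = c := by
  induction S using Finset.induction_on with
  | empty => simp [bernoulliMean]
  | insert a S ha ih => rw [bernoulliMean_insert ha, ih]; ring

theorem bernoulliMean_sub (S : Finset ι) (q : ι → ℝ) (F G : Finset ι → ℝ) :
    bernoulliMean S q (fun W => F W - G W) = bernoulliMean S q F - bernoulliMean S q G := by
  simp [bernoulliMean, mul_sub, Finset.sum_sub_distrib]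

/-- Replacing independent Bernoulli variables by a Poisson variable of the same mean increases the
expected deficit. Each Bernoulli variable added moves along the tangent of the convex Poisson
deficit. -/
theorem bernoulliMean_deficit_le (S : Finset ι) (q : ι → ℝ) (h0 : ∀ i ∈ S, 0 ≤ q i)
    (h1 : ∀ i ∈ S, q i ≤ 1) (k : ℕ) :
    bernoulliMean S q (fun W => ((k - W.card : ℕ) : ℝ)) ≤ poissonDeficit k (∑ i ∈ S, q i) := by
  induction S using Finset.induction_on generalizing k with
  | empty => simp [bernoulliMean, poissonDeficit, poissonBelow, poissonWeight,
      Finset.sum_range_succ']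
  | insert a S ha ih =>
    have h0' : ∀ i ∈ S, 0 ≤ q i := fun i hi => h0 i (Finset.mem_insert_of_mem hi)
    have h1' : ∀ i ∈ S, q i ≤ 1 := fun i hi => h1 i (Finset.mem_insert_of_mem hi)
    have ha0 := h0 a (Finset.mem_insert_self _ _)
    have ha1 := h1 a (Finset.mem_insert_self _ _)
    have e : bernoulliMean S q (fun W => ((k - (insert a W).card : ℕ) : ℝ)) =
        bernoulliMean S q (fun W => (((k - 1) - W.card : ℕ) : ℝ)) := by
      refine bernoulliMean_congr (fun _ _ => rfl) fun W hW => ?_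
      rw [Finset.card_insert_of_notMem fun h => ha (hW h)]
      congr 1
      omega
    have hstep : poissonDeficit (k - 1) (∑ i ∈ S, q i) =
        poissonDeficit k (∑ i ∈ S, q i) - poissonBelow k (∑ i ∈ S, q i) := by
      cases k with
      | zero => simp [poissonDeficit, poissonBelow]
      | succ k => rw [poissonDeficit_succ]; simp
    have hS := poissonDeficit_tangent_le k (Finset.sum_nonneg h0') ha0
    rw [bernoulliMean_insert ha, e, Finset.sum_insert ha, add_comm (q a)]
    have i1 := mul_le_mul_of_nonneg_left (ih h0' h1' k) (sub_nonneg.2 ha1)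
    have i2 := mul_le_mul_of_nonneg_left (ih h0' h1' (k - 1)) ha0
    rw [hstep] at i2
    linarith

/-- The sharp bound for truncated sums of independent Bernoulli variables of total mean at most
`k`. -/
theorem le_bernoulliMean_min {S : Finset ι} {q : ι → ℝ} (h0 : ∀ i ∈ S, 0 ≤ q i)
    (h1 : ∀ i ∈ S, q i ≤ 1) {k : ℕ} (hk : 1 ≤ k) (hq : ∑ i ∈ S, q i ≤ k) :
    (1 - poissonWeight k k) * ∑ i ∈ S, q i ≤
      bernoulliMean S q (fun W => ((min k W.card : ℕ) : ℝ)) := by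
  have e : bernoulliMean S q (fun W => ((min k W.card : ℕ) : ℝ)) =
      k - bernoulliMean S q (fun W => ((k - W.card : ℕ) : ℝ)) := by
    conv_rhs => rw [← bernoulliMean_const S q (k : ℝ), ← bernoulliMean_sub]
    refine bernoulliMean_congr (fun _ _ => rfl) fun W _ => ?_
    rw [eq_sub_iff_add_eq]
    norm_cast
    omega
  rw [e]
  have := bernoulliMean_deficit_le S q h0 h1 k
  have := mul_le_sub_poissonDeficit hk (Finset.sum_nonneg h0) hq
  linarith

/-- The mean of independent Bernoulli variables is affine in the probability at each single index,
so mixing over that probability only averages it. -/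
theorem sum_mul_bernoulliMean {σ : Type*} (J : Finset σ) (w : σ → ℝ) (hw : ∑ s ∈ J, w s = 1)
    (S : Finset ι) (q : σ → ι → ℝ) {a : ι} (ha : a ∈ S)
    (hq : ∀ i ≠ a, ∀ s s', q s i = q s' i) (F : Finset ι → ℝ) :
    ∑ s ∈ J, w s * bernoulliMean S (q s) F =
      bernoulliMean S (fun i => ∑ s ∈ J, w s * q s i) F := by
  have hJ : J.Nonempty := by
    by_contra h
    simp [Finset.not_nonempty_iff_eq_empty.1 h] at hw
  obtain ⟨s₀, -⟩ := hJ
  have hoff : ∀ i ∈ S.erase a, ∀ s, q s i = q s₀ i := fun i hi s =>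
    hq i (Finset.ne_of_mem_erase hi) s s₀
  have hQ : ∀ i ∈ S.erase a, ∑ s ∈ J, w s * q s i = q s₀ i := fun i hi => by
    simp_rw [hoff i hi]
    rw [← Finset.sum_mul, hw, one_mul]
  have hsplit : ∀ q' : ι → ℝ, (∀ i ∈ S.erase a, q' i = q s₀ i) → bernoulliMean S q' F =
      (1 - q' a) * bernoulliMean (S.erase a) (q s₀) F +
        q' a * bernoulliMean (S.erase a) (q s₀) (fun W => F (insert a W)) := fun q' h => by
    conv_lhs => rw [← Finset.insert_erase ha, bernoulliMean_insert (Finset.notMem_erase a S)]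
    rw [bernoulliMean_congr h fun _ _ => rfl, bernoulliMean_congr h fun _ _ => rfl]
  rw [hsplit _ hQ, Finset.sum_congr rfl fun s _ => by rw [hsplit _ fun i hi => hoff i hi s]]
  generalize bernoulliMean (S.erase a) (q s₀) F = X
  generalize bernoulliMean (S.erase a) (q s₀) (fun W => F (insert a W)) = Y
  calc ∑ s ∈ J, w s * ((1 - q s a) * X + q s a * Y)
      = ∑ s ∈ J, (w s * X - w s * q s a * X + w s * q s a * Y) :=
        Finset.sum_congr rfl fun s _ => by ring
    _ = _ := by
      rw [Finset.sum_add_distrib, Finset.sum_sub_distrib, ← Finset.sum_mul, ← Finset.sum_mul,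
        ← Finset.sum_mul, hw, sub_mul]

open Classical in
/-- Independence of the coordinates of a uniformly random point of a product of finite sets. -/
theorem expect_piFinset_filter [Fintype ι] {β : Type*} (s : ι → Finset β)
    (hs : ∀ i, (s i).Nonempty) (P : ι → β → Prop) (F : Finset ι → ℝ) :
    (𝔼 r ∈ Fintype.piFinset s, F (Finset.univ.filter fun i => P i (r i))) =
      bernoulliMean Finset.univ
        (fun i => (((s i).filter (P i)).card : ℝ) / ((s i).card : ℝ)) F := by
  have hF : ∀ r : ι → β, F (Finset.univ.filter fun i => P i (r i)) =
      ∑ W ∈ Finset.univ.powerset,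
        (∏ i, if i ∈ W then (if P i (r i) then 1 else 0) else (if P i (r i) then 0 else 1)) *
          F W := by
    intro r
    rw [Finset.sum_eq_single (Finset.univ.filter fun i => P i (r i))]
    · rw [Finset.prod_eq_one, one_mul]
      intro i _
      by_cases h : P i (r i) <;> simp [h]
    · intro W _ hW
      obtain ⟨i, hi⟩ : ∃ i, ¬ (i ∈ W ↔ P i (r i)) := by
        by_contra! h
        exact hW (by ext i; simp [h i])
      rw [Finset.prod_eq_zero (Finset.mem_univ i), zero_mul]
      by_cases h : P i (r i) <;> simp_all
    · simp
  simp_rw [hF]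
  rw [Finset.expect_eq_sum_div_card, Finset.sum_comm, Finset.sum_div, bernoulliMean]
  refine Finset.sum_congr rfl fun W _ => ?_
  rw [← Finset.sum_mul, ← Finset.prod_univ_sum (t := s) (f := fun i b =>
    if i ∈ W then (if P i b then (1 : ℝ) else 0) else (if P i b then 0 else 1)),
    Fintype.card_piFinset, mul_div_right_comm]
  push_cast
  rw [← Finset.prod_div_distrib]
  congr 1
  refine Finset.prod_congr rfl fun i _ => ?_
  have hc : ((s i).card : ℝ) ≠ 0 := by exact_mod_cast (hs i).card_ne_zero
  by_cases h : i ∈ W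
  · simp [h]
  · have : ((s i).card : ℝ) = ((s i).filter (P i)).card + ((s i).filter fun b => ¬ P i b).card := by
      exact_mod_cast (Finset.card_filter_add_card_filter_not (s := s i) (P i)).symm
    simp only [h, if_false]
    rw [eq_sub_iff_add_eq, ← add_div, div_eq_one_iff_eq hc, this, Finset.sum_ite]
    simp [add_comm]

/-! ### Threshold decomposition of top-`k` sums -/

/-- The `k` largest elements: one set `S` that is optimal at all thresholds. -/
theorem exists_top_subset (v : ι → ℝ) (k : ℕ) (R : Finset ι) :
    ∃ S ⊆ R, S.card ≤ k ∧ ∀ θ : ℝ,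
      min k (R.filter fun i => θ ≤ v i).card ≤ (S.filter fun i => θ ≤ v i).card := by
  induction k generalizing R with
  | zero => exact ⟨∅, by simp, by simp, by simp⟩
  | succ k ih =>
    rcases R.eq_empty_or_nonempty with rfl | hR
    · exact ⟨∅, by simp, by simp, by simp⟩
    obtain ⟨m, hm, hmax⟩ := R.exists_max_image v hR
    obtain ⟨S, hS, hSk, hθ⟩ := ih (R.erase m)
    have hmS : m ∉ S := fun h => by simpa using hS h
    refine ⟨insert m S, ?_, ?_, fun θ => ?_⟩
    · exact Finset.insert_subset hm (hS.trans (Finset.erase_subset _ _))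
    · rw [Finset.card_insert_of_notMem hmS]; omega
    · by_cases h : θ ≤ v m
      · have e : (R.filter fun i => θ ≤ v i) =
            insert m ((R.erase m).filter fun i => θ ≤ v i) := by
          rw [← Finset.insert_erase hm, Finset.filter_insert, if_pos h]
          simp
        rw [e, Finset.filter_insert, if_pos h, Finset.card_insert_of_notMem (by simp),
          Finset.card_insert_of_notMem (by simp [hmS])]
        have := hθ θ
        omega
      · have e : (R.filter fun i => θ ≤ v i) = ∅ :=
          Finset.filter_eq_empty_iff.2 fun i hi hle => h (hle.trans (hmax i hi))
        simp [e]

end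

theorem antitone_indicator_le (v : ℝ) : Antitone fun θ : ℝ => if θ ≤ v then (1 : ℝ) else 0 := by
  intro a b hab
  dsimp only
  by_cases hb : b ≤ v
  · simp [hb, hab.trans hb]
  · rw [if_neg hb]; split_ifs <;> norm_num

theorem integral_indicator_le {v : ℝ} (h0 : 0 ≤ v) (h1 : v ≤ 1) :
    ∫ θ in (0 : ℝ)..1, (if θ ≤ v then (1 : ℝ) else 0) = v := by
  have h := intervalIntegral.integral_indicator (f := fun _ : ℝ => (1 : ℝ)) (μ := MeasureTheory.volume)
    (a₁ := 0) (a₂ := v) (a₃ := 1) ⟨h0, h1⟩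
  simp only [intervalIntegral.integral_const, sub_zero, smul_eq_mul, mul_one] at h
  refine Eq.trans (intervalIntegral.integral_congr fun θ _ => ?_) h
  simp [Set.indicator_apply]

theorem antitone_card_filter_le {ι : Type*} (v : ι → ℝ) (R : Finset ι) :
    Antitone fun θ : ℝ => (R.filter fun i => θ ≤ v i).card :=
  fun _ _ hab => Finset.card_le_card
    (Finset.monotone_filter_right R fun _ _ h => hab.trans h)

theorem antitone_min_card_filter_le {ι : Type*} (v : ι → ℝ) (k : ℕ) (R : Finset ι) :
    Antitone fun θ : ℝ => ((min k (R.filter fun i => θ ≤ v i).card : ℕ) : ℝ) :=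
  fun _ _ hab => Nat.cast_le.2 (min_le_min_left k (antitone_card_filter_le v R hab))

/-- Some `S ⊆ R` of size at most `k` has a sum of at least the integral over the
thresholds `θ` of the size, truncated at `k`, of the part of `R` above `θ`. -/
theorem exists_integral_min_le_sum {ι : Type*} (v : ι → ℝ) (h0 : ∀ i, 0 ≤ v i)
    (h1 : ∀ i, v i ≤ 1) (k : ℕ) (R : Finset ι) :
    ∃ S ⊆ R, S.card ≤ k ∧
      ∫ θ in (0 : ℝ)..1, ((min k (R.filter fun i => θ ≤ v i).card : ℕ) : ℝ) ≤ ∑ i ∈ S, v i := by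
  classical
  obtain ⟨S, hS, hSk, hθ⟩ := exists_top_subset v k R
  refine ⟨S, hS, hSk, ?_⟩
  have e : ∑ i ∈ S, v i = ∫ θ in (0 : ℝ)..1, ((S.filter fun i => θ ≤ v i).card : ℝ) := by
    simp_rw [Finset.card_filter, Nat.cast_sum, Nat.cast_ite, Nat.cast_one, Nat.cast_zero]
    rw [intervalIntegral.integral_finsetSum
      fun i _ => (antitone_indicator_le (v i)).intervalIntegrable]
    exact Finset.sum_congr rfl fun i _ => (integral_indicator_le (h0 i) (h1 i)).symm
  rw [e]
  refine intervalIntegral.integral_mono_on zero_le_one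
    (antitone_min_card_filter_le v k R).intervalIntegrable
    (Antitone.intervalIntegrable fun a b hab =>
      Nat.cast_le.2 (antitone_card_filter_le v S hab)) fun θ _ => ?_
  exact_mod_cast hθ θ

/-! ### Delays and schedules -/

/-- One delay ago lies either the last play of the arm or time `0`. -/
theorem exists_delay_add_eq {n : ℕ} (A : Schedule n) (i : Fin n) {t : ℕ} (ht : 1 ≤ t) :
    ∃ s, (delay A i t : ℕ) + s = t ∧ (s = 0 ∨ 1 ≤ s ∧ i ∈ A s) := by
  induction t, ht using Nat.le_induction with
  | base => exact ⟨0, by simp [delay], Or.inl rfl⟩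
  | succ t ht ih =>
    by_cases h : i ∈ A t
    · exact ⟨t, by simp [delay, h, add_comm], Or.inr ⟨ht, h⟩⟩
    · obtain ⟨s, hs, hs'⟩ := ih
      have h0 : t ≠ 0 := by omega
      refine ⟨s, ?_, hs'⟩
      simp only [delay, h, h0, or_self, if_false, PNat.add_coe, PNat.one_coe]
      omega

open Classical in
/-- The delays of the plays of an arm, and the time since the last play, add up to the time
elapsed. -/
theorem sum_delay_add_delay {n : ℕ} (A : Schedule n) (i : Fin n) (T : ℕ) :
    ∑ t ∈ Finset.Icc 1 T, (if i ∈ A t then (delay A i t : ℕ) else 0) + (delay A i (T + 1) : ℕ) =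
      T + 1 := by
  induction T with
  | zero => simp [delay]
  | succ T ih =>
    rw [Finset.sum_Icc_succ_top (by omega)]
    have e : delay A i (T + 1 + 1) = if i ∈ A (T + 1) then 1 else delay A i (T + 1) + 1 := by
      simp [delay]
    rw [e]
    by_cases h : i ∈ A (T + 1)
    · simp only [h, if_true, PNat.one_coe]; omega
    · simp only [h, if_false, PNat.add_coe, PNat.one_coe]; omega

namespace RBInstance

variable {n k : ℕ} (I : RBInstance n k)

theorem p_le_of_tauMax_le (i : Fin n) (d : ℕ+) {m : ℕ+} (hm : I.tauMax ≤ m) :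
    I.p i d ≤ I.p i m := by
  rw [I.p_recovery i m ((I.recovery_le i).trans hm),
    ← I.p_recovery i (max d (I.recovery i)) (le_max_right _ _)]
  exact I.p_mono i (le_max_left _ _)

theorem totalPayoff_nonneg (A : Schedule n) (T : ℕ) : 0 ≤ I.totalPayoff A T :=
  Finset.sum_nonneg fun _ _ => Finset.sum_nonneg fun _ _ => I.p_nonneg _ _

theorem opt_nonneg (T : ℕ) : 0 ≤ I.opt T := by
  refine Real.sSup_nonneg ?_
  rintro v ⟨A, -, rfl⟩
  exact I.totalPayoff_nonneg A T

theorem summable_of_feasible {x : Fin n → ℕ+ → ℝ} (hx : x ∈ I.feasible) (i : Fin n) :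
    Summable (x i) :=
  (hx.2.1 i).of_nonneg_of_le (hx.1 i) fun τ =>
    le_mul_of_one_le_left (hx.1 i τ) (Nat.one_le_cast.2 τ.pos)

theorem summable_payoff_of_feasible {x : Fin n → ℕ+ → ℝ} (hx : x ∈ I.feasible) (i : Fin n) :
    Summable fun τ => I.p i τ * x i τ :=
  (I.summable_of_feasible hx i).of_nonneg_of_le
    (fun τ => mul_nonneg (I.p_nonneg i τ) (hx.1 i τ))
    fun τ => mul_le_of_le_one_left (hx.1 i τ) (I.p_le_one i τ)

theorem lpValue_nonneg {x : Fin n → ℕ+ → ℝ} (hx : x ∈ I.feasible) : 0 ≤ I.lpValue x :=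
  Finset.sum_nonneg fun i _ => tsum_nonneg fun τ => mul_nonneg (I.p_nonneg i τ) (hx.1 i τ)

theorem lpValue_le {x : Fin n → ℕ+ → ℝ} (hx : x ∈ I.feasible) : I.lpValue x ≤ k :=
  (Finset.sum_le_sum fun i _ => (I.summable_payoff_of_feasible hx i).tsum_le_tsum
    (fun τ => mul_le_of_le_one_left (hx.1 i τ) (I.p_le_one i τ))
    (I.summable_of_feasible hx i)).trans hx.2.2.1

open Classical in
/-- The frequencies with which a schedule plays each arm under each delay form a feasible LP
solution whose value is the average payoff. -/
theorem exists_feasible_lpValue_eq (A : Schedule n) (hA : ∀ t, (A t).card ≤ k) {T : ℕ}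
    (hT : 1 ≤ T) : ∃ x ∈ I.feasible, T * I.lpValue x = I.totalPayoff A T := by
  have hT' : (0 : ℝ) < T := by exact_mod_cast hT
  let x : Fin n → ℕ+ → ℝ := fun i τ =>
    ∑ t ∈ Finset.Icc 1 T, if τ = delay A i t then (if i ∈ A t then 1 / (T : ℝ) else 0) else 0
  have key : ∀ (i : Fin n) (g : ℕ+ → ℝ), HasSum (fun τ => g τ * x i τ)
      ((∑ t ∈ Finset.Icc 1 T, if i ∈ A t then g (delay A i t) else 0) / T) := by
    intro i g
    have h : ∀ t ∈ Finset.Icc 1 T, HasSum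
        (fun τ => g τ * if τ = delay A i t then (if i ∈ A t then 1 / (T : ℝ) else 0) else 0)
        ((if i ∈ A t then g (delay A i t) else 0) / T) := by
      intro t _
      convert hasSum_ite_eq (delay A i t) ((if i ∈ A t then g (delay A i t) else 0) / (T : ℝ))
        using 2 with τ
      by_cases h1 : τ = delay A i t
      · subst h1
        by_cases h2 : i ∈ A t <;> simp [h2, div_eq_mul_inv]
      · simp [h1]
    have := hasSum_sum h
    rw [Finset.sum_div]
    simpa only [x, Finset.mul_sum] using this
  have key1 : ∀ i, ∑' τ, x i τ = (∑ t ∈ Finset.Icc 1 T, if i ∈ A t then (1 : ℝ) else 0) / T := by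
    intro i
    simpa using (key i fun _ => 1).tsum_eq
  refine ⟨x, ⟨fun i τ => ?_, fun i => (key i _).summable, ?_, fun i => ?_⟩, ?_⟩
  · exact Finset.sum_nonneg fun t _ => by split_ifs <;> positivity
  · simp_rw [key1]
    rw [← Finset.sum_div, Finset.sum_comm, div_le_iff₀ hT']
    calc _ ≤ ∑ t ∈ Finset.Icc 1 T, (k : ℝ) := Finset.sum_le_sum fun t _ => by
          simpa using hA t
      _ = k * T := by simp [mul_comm]
  · rw [(key i fun τ => ((τ : ℕ) : ℝ)).tsum_eq, div_le_one hT']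
    have h := sum_delay_add_delay A i T
    have h' := (delay A i (T + 1)).pos
    have : ∑ t ∈ Finset.Icc 1 T, (if i ∈ A t then (delay A i t : ℕ) else 0) ≤ T := by omega
    exact_mod_cast this
  · rw [lpValue, Finset.sum_congr rfl fun i _ => (key i (I.p i)).tsum_eq, ← Finset.sum_div,
      mul_div_cancel₀ _ hT'.ne', Finset.sum_comm, totalPayoff]
    exact Finset.sum_congr rfl fun t _ => by simp [Finset.sum_ite_mem]

/-- The LP bounds the long-run average of every schedule. -/
theorem opt_le {x : Fin n → ℕ+ → ℝ} (hx : I.IsOptimalExtremePoint x) (T : ℕ) :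
    I.opt T ≤ T * I.lpValue x := by
  refine csSup_le ⟨_, fun _ => ∅, by simp, rfl⟩ ?_
  rintro v ⟨A, hA, rfl⟩
  rcases Nat.eq_zero_or_pos T with rfl | hT
  · simp [totalPayoff]
  obtain ⟨y, hy, hv⟩ := I.exists_feasible_lpValue_eq A hA hT
  rw [← hv]
  exact mul_le_mul_of_nonneg_left (hx.2 y hy) (Nat.cast_nonneg T)

/-! ### The online phase -/

theorem exists_greedy (C : Finset (Fin n)) (d : Fin n → ℕ+) :
    ∃ S ⊆ C, S.card ≤ k ∧ ∀ S' ⊆ C, S'.card ≤ k → ∑ i ∈ S', I.p i (d i) ≤ ∑ i ∈ S, I.p i (d i) := by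
  obtain ⟨S, hS, hmax⟩ := (C.powerset.filter fun S => S.card ≤ k).exists_max_image
    (fun S => ∑ i ∈ S, I.p i (d i)) ⟨∅, by simp⟩
  simp only [Finset.mem_filter, Finset.mem_powerset] at hS hmax
  exact ⟨S, hS.1, hS.2, fun S' h1 h2 => hmax S' ⟨h1, h2⟩⟩

open Classical in
theorem exists_isOnlineRun (c : Fin n → Option ℕ+) (r : Fin n → ℕ) :
    ∃ A : Schedule n, I.IsOnlineRun c r A := by
  choose g hg1 hg2 hg3 using fun C : Finset (Fin n) => fun d => I.exists_greedy C d
  -- the vector of delays is the state of the greedy recursion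
  let D : ℕ → Fin n → ℕ+ := fun t => Nat.rec (fun _ => 1)
    (fun t d i => if t = 0 ∨ i ∈ g (candidates c r t) d then 1 else d i + 1) t
  let A : Schedule n := fun t => g (candidates c r t) (D t)
  have hD : ∀ t i, delay A i t = D t i := by
    intro t
    induction t with
    | zero => intro i; rfl
    | succ t ih =>
      intro i
      rw [delay, ih i]
  refine ⟨A, fun t _ => ⟨hg1 _ _, hg2 _ _, ?_⟩⟩
  simp_rw [hD]
  exact hg3 _ _

/-- From round `tauMax` on, an arm yields at least the payoff of its critical delay whenever it is
a candidate: earlier plays are a multiple of the critical delay ago, and an arm that was not played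
before has recovered. -/
theorem p_le_p_delay {c : Fin n → Option ℕ+} {r : Fin n → ℕ} {A : Schedule n}
    (hA : I.IsOnlineRun c r A) {t : ℕ} (ht : (I.tauMax : ℕ) ≤ t) {i : Fin n} {d : ℕ+}
    (hc : c i = some d) (hr : t % (d : ℕ) = r i) : I.p i d ≤ I.p i (delay A i t) := by
  have ht1 : 1 ≤ t := le_trans I.tauMax.pos ht
  obtain ⟨s, hs, rfl | ⟨hs1, hsA⟩⟩ := exists_delay_add_eq A i ht1
  · refine I.p_le_of_tauMax_le i d ?_
    rw [← PNat.coe_le_coe]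
    omega
  · refine I.p_mono i ?_
    have hmem := (hA s hs1).1 hsA
    simp only [candidates, Finset.mem_filter, Finset.mem_univ, true_and] at hmem
    obtain ⟨d', hd', hs'⟩ := hmem
    obtain rfl : d = d' := by rw [hc] at hd'; exact Option.some.inj hd'
    have hmod : s % (d : ℕ) = t % (d : ℕ) := by rw [hs', hr]
    have hdvd : (d : ℕ) ∣ t - s := (Nat.modEq_iff_dvd' (by omega)).1 hmod
    rw [← PNat.coe_le_coe]
    have he : t - s = (delay A i t : ℕ) := by omega
    rw [he] at hdvd
    exact Nat.le_of_dvd (delay A i t).pos hdvd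

end RBInstance

namespace RBInstance

variable {n k : ℕ} (I : RBInstance n k)

/-! ### Existence of an optimal extreme point -/

/-- The face of the LP polytope on which all variables of delay more than `tauMax` vanish. -/
def truncatedFeasible : Set (Fin n → ℕ+ → ℝ) :=
  {x | (∀ i τ, 0 ≤ x i τ) ∧ (∀ i τ, I.tauMax < τ → x i τ = 0) ∧
    ∑ i, ∑ τ ∈ Finset.Icc 1 I.tauMax, x i τ ≤ (k : ℝ) ∧
    ∀ i, ∑ τ ∈ Finset.Icc 1 I.tauMax, ((τ : ℕ) : ℝ) * x i τ ≤ 1}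

theorem hasSum_of_eq_zero {x : Fin n → ℕ+ → ℝ} (hx : ∀ i τ, I.tauMax < τ → x i τ = 0)
    (g : ℕ+ → ℝ) (i : Fin n) :
    HasSum (fun τ => g τ * x i τ) (∑ τ ∈ Finset.Icc 1 I.tauMax, g τ * x i τ) :=
  hasSum_sum_of_ne_finset_zero fun τ hτ => by
    have : I.tauMax < τ := by
      by_contra h
      exact hτ (Finset.mem_Icc.2 ⟨one_le, not_lt.1 h⟩)
    rw [hx i τ this, mul_zero]

theorem mem_truncatedFeasible_iff {x : Fin n → ℕ+ → ℝ} :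
    x ∈ I.truncatedFeasible ↔ x ∈ I.feasible ∧ ∀ i τ, I.tauMax < τ → x i τ = 0 := by
  have h1 : (∀ i τ, I.tauMax < τ → x i τ = 0) →
      ∀ i, ∑' τ, x i τ = ∑ τ ∈ Finset.Icc 1 I.tauMax, x i τ := fun h i => by
    simpa using (I.hasSum_of_eq_zero h (fun _ => 1) i).tsum_eq
  have h2 : (∀ i τ, I.tauMax < τ → x i τ = 0) → ∀ i, HasSum (fun τ : ℕ+ => ((τ : ℕ) : ℝ) * x i τ)
      (∑ τ ∈ Finset.Icc 1 I.tauMax, ((τ : ℕ) : ℝ) * x i τ) := fun h i =>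
    I.hasSum_of_eq_zero h (fun τ => ((τ : ℕ) : ℝ)) i
  constructor
  · rintro ⟨h0, hz, hk, hr⟩
    refine ⟨⟨h0, fun i => (h2 hz i).summable, ?_, fun i => ?_⟩, hz⟩
    · simpa only [h1 hz] using hk
    · simpa only [(h2 hz i).tsum_eq] using hr i
  · rintro ⟨⟨h0, -, hk, hr⟩, hz⟩
    refine ⟨h0, hz, ?_, fun i => ?_⟩
    · simpa only [h1 hz] using hk
    · simpa only [(h2 hz i).tsum_eq] using hr i

theorem isCompact_truncatedFeasible : IsCompact I.truncatedFeasible := by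
  have hbox : IsCompact (Set.pi Set.univ fun _ : Fin n => Set.pi Set.univ fun _ : ℕ+ =>
      Set.Icc (0 : ℝ) 1) :=
    isCompact_univ_pi fun _ => isCompact_univ_pi fun _ => isCompact_Icc
  refine hbox.of_isClosed_subset ?_ fun x hx => ?_
  · simp only [truncatedFeasible, Set.ofPred_and, Set.ofPred_forall]
    refine IsClosed.inter ?_ (IsClosed.inter ?_ (IsClosed.inter ?_ ?_))
    · exact isClosed_iInter fun i => isClosed_iInter fun τ =>
        isClosed_le continuous_const (by fun_prop)
    · exact isClosed_iInter fun i => isClosed_iInter fun τ => isClosed_iInter fun _ =>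
        isClosed_eq (by fun_prop) continuous_const
    · exact isClosed_le (by fun_prop) continuous_const
    · exact isClosed_iInter fun i => isClosed_le (by fun_prop) continuous_const
  · have hf := (I.mem_truncatedFeasible_iff.1 hx).1
    refine fun i _ τ _ => ⟨hf.1 i τ, ?_⟩
    calc x i τ ≤ ((τ : ℕ) : ℝ) * x i τ :=
          le_mul_of_one_le_left (hf.1 i τ) (Nat.one_le_cast.2 τ.pos)
      _ ≤ ∑' τ : ℕ+, ((τ : ℕ) : ℝ) * x i τ := (hf.2.1 i).le_tsum τ fun σ _ =>
          mul_nonneg (Nat.cast_nonneg _) (hf.1 i σ)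
      _ ≤ 1 := hf.2.2.2 i

theorem lpValue_eq_of_truncated {x : Fin n → ℕ+ → ℝ} (hx : x ∈ I.truncatedFeasible) :
    I.lpValue x = ∑ i, ∑ τ ∈ Finset.Icc 1 I.tauMax, I.p i τ * x i τ :=
  Finset.sum_congr rfl fun i _ => (I.hasSum_of_eq_zero hx.2.1 (I.p i) i).tsum_eq

/-- Moving all weight beyond `tauMax` to `tauMax` keeps a solution feasible and its value. -/
theorem exists_truncated_lpValue_eq {y : Fin n → ℕ+ → ℝ} (hy : y ∈ I.feasible) :
    ∃ z ∈ I.truncatedFeasible, I.lpValue z = I.lpValue y := by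
  classical
  let z : Fin n → ℕ+ → ℝ := fun i τ => ∑' σ, if min σ I.tauMax = τ then y i σ else 0
  have hsum : ∀ i τ, Summable fun σ => if min σ I.tauMax = τ then y i σ else 0 := fun i τ =>
    (I.summable_of_feasible hy i).of_nonneg_of_le
      (fun σ => by split_ifs; exacts [hy.1 i σ, le_rfl])
      (fun σ => by split_ifs; exacts [le_rfl, hy.1 i σ])
  have key : ∀ i (g : ℕ+ → ℝ), ∑ τ ∈ Finset.Icc 1 I.tauMax, g τ * z i τ =
      ∑' σ, g (min σ I.tauMax) * y i σ := by
    intro i g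
    simp_rw [z, ← tsum_mul_left]
    rw [← Summable.tsum_finsetSum fun τ _ => (hsum i τ).mul_left (g τ)]
    refine tsum_congr fun σ => ?_
    simp_rw [mul_ite, mul_zero]
    rw [Finset.sum_ite_eq, if_pos (Finset.mem_Icc.2 ⟨one_le, min_le_right _ _⟩)]
  have hz : z ∈ I.truncatedFeasible := by
    refine ⟨fun i τ => tsum_nonneg fun σ => ?_, fun i τ hτ => ?_, ?_, fun i => ?_⟩
    · split_ifs
      exacts [hy.1 i σ, le_rfl]
    · have : ∀ σ, (if min σ I.tauMax = τ then y i σ else 0) = 0 := fun σ =>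
        if_neg fun h => (h ▸ min_le_right σ I.tauMax).not_gt hτ
      simp [z, this]
    · have h : ∀ i, ∑ τ ∈ Finset.Icc 1 I.tauMax, z i τ = ∑' σ, y i σ := fun i => by
        simpa using key i fun _ => 1
      simpa only [h] using hy.2.2.1
    · rw [key i fun τ => ((τ : ℕ) : ℝ)]
      have hle : ∀ σ : ℕ+, (((min σ I.tauMax : ℕ+) : ℕ) : ℝ) * y i σ ≤ ((σ : ℕ) : ℝ) * y i σ :=
        fun σ => mul_le_mul_of_nonneg_right
          (Nat.cast_le.2 (PNat.coe_le_coe _ _ |>.2 (min_le_left _ _))) (hy.1 i σ)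
      exact (((hy.2.1 i).of_nonneg_of_le
        (fun σ => mul_nonneg (Nat.cast_nonneg _) (hy.1 i σ)) hle).tsum_le_tsum hle
          (hy.2.1 i)).trans (hy.2.2.2 i)
  refine ⟨z, hz, ?_⟩
  rw [I.lpValue_eq_of_truncated hz, lpValue]
  refine Finset.sum_congr rfl fun i _ => ?_
  rw [key i (I.p i)]
  refine tsum_congr fun σ => ?_
  congr 1
  rcases le_total σ I.tauMax with h | h
  · rw [min_eq_left h]
  · rw [min_eq_right h]
    exact le_antisymm (I.p_mono i h) (I.p_le_of_tauMax_le i σ le_rfl)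

theorem exists_isOptimalExtremePoint : ∃ x, I.IsOptimalExtremePoint x := by
  let L : (Fin n → ℕ+ → ℝ) → ℝ := fun x => ∑ i, ∑ τ ∈ Finset.Icc 1 I.tauMax, I.p i τ * x i τ
  have hL : Continuous L := by fun_prop
  have hLv : ∀ x ∈ I.truncatedFeasible, I.lpValue x = L x := fun x => I.lpValue_eq_of_truncated
  have hne : I.truncatedFeasible.Nonempty := ⟨0, by simp [truncatedFeasible]⟩
  obtain ⟨m, hm, hmax⟩ := I.isCompact_truncatedFeasible.exists_isMaxOn hne hL.continuousOn
  have hM : IsCompact (I.truncatedFeasible ∩ {x | L m ≤ L x}) :=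
    I.isCompact_truncatedFeasible.inter_right (isClosed_le continuous_const hL)
  obtain ⟨x, hx⟩ := hM.extremePoints_nonempty ⟨m, hm, le_refl (L m)⟩
  obtain ⟨⟨hxT, hxm⟩, hext⟩ := mem_extremePoints.1 hx
  have hxf := I.mem_truncatedFeasible_iff.1 hxT
  refine ⟨x, mem_extremePoints.2 ⟨hxf.1, fun y₁ h₁ y₂ h₂ hseg => ?_⟩, fun y hy => ?_⟩
  · have hseg' := hseg
    obtain ⟨a, b, ha, hb, hab, hxy⟩ := hseg
    have hc : ∀ i τ, x i τ = a * y₁ i τ + b * y₂ i τ := fun i τ => by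
      rw [← hxy]; simp
    have hz : ∀ i τ, I.tauMax < τ → y₁ i τ = 0 ∧ y₂ i τ = 0 := by
      intro i τ hτ
      have h := hc i τ
      rw [hxf.2 i τ hτ] at h
      have e1 := mul_nonneg ha.le (h₁.1 i τ)
      have e2 := mul_nonneg hb.le (h₂.1 i τ)
      constructor
      · exact (mul_eq_zero.1 (by linarith : a * y₁ i τ = 0)).resolve_left ha.ne'
      · exact (mul_eq_zero.1 (by linarith : b * y₂ i τ = 0)).resolve_left hb.ne'
    have t₁ := I.mem_truncatedFeasible_iff.2 ⟨h₁, fun i τ hτ => (hz i τ hτ).1⟩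
    have t₂ := I.mem_truncatedFeasible_iff.2 ⟨h₂, fun i τ hτ => (hz i τ hτ).2⟩
    have hLx : L x = a * L y₁ + b * L y₂ := by
      simp only [L, Finset.mul_sum, ← Finset.sum_add_distrib]
      refine Finset.sum_congr rfl fun i _ => Finset.sum_congr rfl fun τ _ => ?_
      rw [hc]; ring
    have l₁ : L y₁ ≤ L m := hmax t₁
    have l₂ : L y₂ ≤ L m := hmax t₂
    have hxm' : L m ≤ L x := hxm
    have g₁ : L m ≤ L y₁ := by
      have : b * L y₂ ≤ b * L m := mul_le_mul_of_nonneg_left l₂ hb.le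
      have hb' : b = 1 - a := by linarith
      have : a * L m ≤ a * L y₁ := by rw [hb'] at this hLx; linarith
      exact le_of_mul_le_mul_left this ha
    have g₂ : L m ≤ L y₂ := by
      have : a * L y₁ ≤ a * L m := mul_le_mul_of_nonneg_left l₁ ha.le
      have ha' : a = 1 - b := by linarith
      have : b * L m ≤ b * L y₂ := by rw [ha'] at this hLx; linarith
      exact le_of_mul_le_mul_left this hb
    exact hext y₁ ⟨t₁, g₁⟩ y₂ ⟨t₂, g₂⟩ hseg'
  · obtain ⟨z, hz, hzv⟩ := I.exists_truncated_lpValue_eq hy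
    rw [← hzv, hLv z hz, hLv x hxT]
    exact (hmax hz).trans hxm

/-! ### The structure of extreme points -/

/-- The change of the total weight of a row along a direction. -/
noncomputable def rowMass : (ℕ+ →₀ ℝ) →ₗ[ℝ] ℝ := Finsupp.linearCombination ℝ fun _ => (1 : ℝ)

/-- The change of the left side of the constraint of an arm along a direction. -/
noncomputable def rowLoad : (ℕ+ →₀ ℝ) →ₗ[ℝ] ℝ :=
  Finsupp.linearCombination ℝ fun τ : ℕ+ => ((τ : ℕ) : ℝ)

@[simp] theorem rowMass_single (τ : ℕ+) (v : ℝ) : rowMass (Finsupp.single τ v) = v := by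
  simp [rowMass]

@[simp] theorem rowLoad_single (τ : ℕ+) (v : ℝ) :
    rowLoad (Finsupp.single τ v) = v * ((τ : ℕ) : ℝ) := by
  simp [rowLoad]

theorem hasSum_rowMass (g : ℕ+ →₀ ℝ) : HasSum g (rowMass g) := by
  have h : HasSum g (∑ τ ∈ g.support, g τ) :=
    hasSum_sum_of_ne_finset_zero fun τ hτ => by simpa using hτ
  simpa [rowMass, Finsupp.linearCombination_apply, Finsupp.sum] using h

theorem hasSum_rowLoad (g : ℕ+ →₀ ℝ) :
    HasSum (fun τ : ℕ+ => ((τ : ℕ) : ℝ) * g τ) (rowLoad g) := by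
  have h : HasSum (fun τ : ℕ+ => ((τ : ℕ) : ℝ) * g τ)
      (∑ τ ∈ g.support, ((τ : ℕ) : ℝ) * g τ) :=
    hasSum_sum_of_ne_finset_zero fun τ hτ => by
      rw [Finsupp.notMem_support_iff.1 hτ, mul_zero]
  simpa [rowLoad, Finsupp.linearCombination_apply, Finsupp.sum, mul_comm] using h

/-- At an extreme point no non-zero direction stays in the support, preserves the total weight, and
changes the load of no arm whose constraint is tight. -/
theorem direction_eq_zero {x : Fin n → ℕ+ → ℝ} (hx : x ∈ Set.extremePoints ℝ I.feasible)
    (d : Fin n → ℕ+ →₀ ℝ) (hd : ∀ i τ, d i τ ≠ 0 → 0 < x i τ) (hmass : ∑ i, rowMass (d i) = 0)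
    (hload : ∀ i, rowLoad (d i) = 0 ∨ ∑' τ : ℕ+, ((τ : ℕ) : ℝ) * x i τ < 1) (i : Fin n) :
    d i = 0 := by
  obtain ⟨hxf, hext⟩ := mem_extremePoints.1 hx
  have hev : ∀ᶠ ε : ℝ in nhds 0, (∀ i, ∀ τ ∈ (d i).support, 0 ≤ x i τ + ε * d i τ) ∧
      ∀ i, ∑' τ : ℕ+, ((τ : ℕ) : ℝ) * x i τ + ε * rowLoad (d i) ≤ 1 := by
    refine Filter.Eventually.and ?_ ?_
    · refine Filter.eventually_all.2 fun i => (Finset.eventually_all _).2 fun τ hτ => ?_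
      have hc : Filter.Tendsto (fun ε : ℝ => x i τ + ε * d i τ) (nhds 0) (nhds (x i τ)) := by
        have : Continuous fun ε : ℝ => x i τ + ε * d i τ := by fun_prop
        simpa using this.tendsto 0
      filter_upwards [hc.eventually (lt_mem_nhds (hd i τ (Finsupp.mem_support_iff.1 hτ)))] with
        ε hε using hε.le
    · refine Filter.eventually_all.2 fun i => ?_
      rcases hload i with h | h
      · exact Filter.Eventually.of_forall fun ε => by simpa [h] using hxf.2.2.2 i
      · have hc : Filter.Tendsto
            (fun ε : ℝ => ∑' τ : ℕ+, ((τ : ℕ) : ℝ) * x i τ + ε * rowLoad (d i)) (nhds 0)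
            (nhds (∑' τ : ℕ+, ((τ : ℕ) : ℝ) * x i τ)) := by
          have : Continuous
            fun ε : ℝ => ∑' τ : ℕ+, ((τ : ℕ) : ℝ) * x i τ + ε * rowLoad (d i) := by fun_prop
          simpa using this.tendsto 0
        filter_upwards [hc.eventually (gt_mem_nhds h)] with ε hε using hε.le
  obtain ⟨δ, hδ, hball⟩ := Metric.eventually_nhds_iff.1 hev
  have hmem : ∀ ε : ℝ, |ε| < δ → (fun i τ => x i τ + ε * d i τ) ∈ I.feasible := by
    intro ε hε
    obtain ⟨hpos, hrow⟩ := hball (y := ε) (by simpa [Real.dist_eq] using hε)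
    have hL : ∀ i, HasSum (fun τ : ℕ+ => ((τ : ℕ) : ℝ) * (x i τ + ε * d i τ))
        (∑' τ : ℕ+, ((τ : ℕ) : ℝ) * x i τ + ε * rowLoad (d i)) := by
      intro i
      convert (hxf.2.1 i).hasSum.add ((hasSum_rowLoad (d i)).mul_left ε) using 2 with τ
      ring
    have hM : ∀ i, ∑' τ, (x i τ + ε * d i τ) = ∑' τ, x i τ + ε * rowMass (d i) := fun i =>
      ((I.summable_of_feasible hxf i).hasSum.add ((hasSum_rowMass (d i)).mul_left ε)).tsum_eq
    refine ⟨fun i τ => ?_, fun i => (hL i).summable, ?_, fun i => ?_⟩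
    · by_cases h : d i τ = 0
      · simpa [h] using hxf.1 i τ
      · exact hpos i τ (Finsupp.mem_support_iff.2 h)
    · simp_rw [hM]
      rw [Finset.sum_add_distrib, ← Finset.mul_sum, hmass, mul_zero, add_zero]
      exact hxf.2.2.1
    · rw [(hL i).tsum_eq]
      exact hrow i
  have h₁ := hmem (δ / 2) (by rw [abs_of_pos (by linarith)]; linarith)
  have h₂ := hmem (-(δ / 2)) (by rw [abs_neg, abs_of_pos (by linarith)]; linarith)
  have hx₁ := (hext _ h₁ _ h₂ ⟨1 / 2, 1 / 2, by norm_num, by norm_num, by norm_num, by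
    funext i τ; simp; ring⟩).1
  ext τ
  have := congrFun (congrFun hx₁ i) τ
  simp only [add_eq_left, mul_eq_zero] at this
  simpa using this.resolve_left (by linarith)

/-- The constraint of an arm forces all variables but one to vanish once that one is `1 / τ`. -/
theorem eq_zero_of_eq_one_div {x : Fin n → ℕ+ → ℝ} (hx : x ∈ I.feasible) {i : Fin n} {τ σ : ℕ+}
    (h : x i τ = 1 / ((τ : ℕ) : ℝ)) (hσ : σ ≠ τ) : x i σ = 0 := by
  have hτ : (0 : ℝ) < (τ : ℕ) := Nat.cast_pos.2 τ.pos
  have hσ' : (0 : ℝ) < (σ : ℕ) := Nat.cast_pos.2 σ.pos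
  have hs := (hx.2.1 i).sum_le_tsum {σ, τ} fun τ _ =>
    mul_nonneg (Nat.cast_nonneg _) (hx.1 i τ)
  rw [Finset.sum_pair hσ, h, mul_one_div_cancel hτ.ne'] at hs
  have h1 := hx.2.2.2 i
  have h2 := mul_nonneg hσ'.le (hx.1 i σ)
  exact (mul_eq_zero.1 (by linarith : ((σ : ℕ) : ℝ) * x i σ = 0)).resolve_left hσ'.ne'

theorem le_one_div {x : Fin n → ℕ+ → ℝ} (hx : x ∈ I.feasible) (i : Fin n) (τ : ℕ+) :
    x i τ ≤ 1 / ((τ : ℕ) : ℝ) := by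
  rw [le_div_iff₀' (Nat.cast_pos.2 τ.pos)]
  exact ((hx.2.1 i).le_tsum τ fun σ _ => mul_nonneg (Nat.cast_nonneg _) (hx.1 i σ)).trans
    (hx.2.2.2 i)

/-- A supported arm without a variable of value `1 / τ` can exchange weight with the rest: if its
constraint has slack, by scaling a variable; otherwise it has two positive variables, which can be
traded against each other. -/
theorem exists_direction {x : Fin n → ℕ+ → ℝ} (hx : x ∈ I.feasible) {i : Fin n}
    (hs : Supported x i) (hirr : ∀ τ : ℕ+, x i τ ≠ 1 / ((τ : ℕ) : ℝ)) :
    ∃ g : ℕ+ →₀ ℝ, (∀ τ, g τ ≠ 0 → 0 < x i τ) ∧ rowMass g ≠ 0 ∧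
      (rowLoad g = 0 ∨ ∑' τ : ℕ+, ((τ : ℕ) : ℝ) * x i τ < 1) := by
  obtain ⟨τ, hτ⟩ := hs
  rcases (hx.2.2.2 i).lt_or_eq with hlt | heq
  · refine ⟨Finsupp.single τ 1, fun σ hσ => ?_, by simp, Or.inr hlt⟩
    rw [Finsupp.single_apply_ne_zero] at hσ
    exact hσ.1 ▸ hτ
  · have hτ' : ((τ : ℕ) : ℝ) ≠ 0 := Nat.cast_ne_zero.2 τ.ne_zero
    obtain ⟨σ, hστ, hσ⟩ : ∃ σ, σ ≠ τ ∧ x i σ ≠ 0 := by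
      by_contra! h
      rw [tsum_eq_single τ fun σ hσ => by rw [h σ hσ, mul_zero]] at heq
      exact hirr τ (by rw [eq_div_iff hτ', mul_comm]; exact heq)
    have hσ' : ((σ : ℕ) : ℝ) ≠ 0 := Nat.cast_ne_zero.2 σ.ne_zero
    refine ⟨Finsupp.single τ (1 / ((τ : ℕ) : ℝ)) - Finsupp.single σ (1 / ((σ : ℕ) : ℝ)),
      fun ρ hρ => ?_, ?_, Or.inl ?_⟩
    · by_cases h1 : ρ = τ
      · exact h1 ▸ hτ
      by_cases h2 : ρ = σ
      · exact h2 ▸ (hx.1 i σ).lt_of_ne' hσ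
      · exact absurd (by simp [h1, h2]) hρ
    · rw [map_sub, rowMass_single, rowMass_single, sub_ne_zero]
      intro h
      rw [one_div, one_div, inv_inj, Nat.cast_inj, PNat.coe_inj] at h
      exact hστ h.symm
    · rw [map_sub, rowLoad_single, rowLoad_single, one_div_mul_cancel hτ', one_div_mul_cancel hσ',
        sub_self]

/-- At most one arm is irregular: two of them could exchange weight. -/
theorem irregular_unique {x : Fin n → ℕ+ → ℝ} (hx : x ∈ Set.extremePoints ℝ I.feasible)
    {i j : Fin n} (hi : Supported x i) (hi' : ∀ τ : ℕ+, x i τ ≠ 1 / ((τ : ℕ) : ℝ))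
    (hj : Supported x j) (hj' : ∀ τ : ℕ+, x j τ ≠ 1 / ((τ : ℕ) : ℝ)) : i = j := by
  by_contra hij
  obtain ⟨g, hg, hgm, hgl⟩ := I.exists_direction hx.1 hi hi'
  obtain ⟨f, hf, hfm, hfl⟩ := I.exists_direction hx.1 hj hj'
  have h := I.direction_eq_zero hx
    (fun l => if l = i then rowMass f • g else if l = j then -rowMass g • f else 0)
    (fun l τ h => ?_) ?_ (fun l => ?_) i
  · rw [if_pos rfl, smul_eq_zero] at h
    rcases h with h | h
    · exact hfm h
    · exact hgm (by rw [h, map_zero])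
  · split_ifs at h with h1 h2
    · exact h1 ▸ hg τ fun h0 => h (by simp [h0])
    · exact h2 ▸ hf τ fun h0 => h (by simp [h0])
    · exact absurd rfl h
  · rw [← Finset.sum_subset (Finset.subset_univ {i, j}), Finset.sum_pair hij]
    · rw [if_pos rfl, if_neg (Ne.symm hij), if_pos rfl, map_smul, map_smul]
      simp only [smul_eq_mul]
      ring
    · intro l _ hl
      simp only [Finset.mem_insert, Finset.mem_singleton, not_or] at hl
      rw [if_neg hl.1, if_neg hl.2, map_zero]
  · split_ifs with h1 h2
    · subst h1
      exact hgl.imp_left fun h => by rw [map_smul, h, smul_zero]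
    · subst h2
      exact hfl.imp_left fun h => by rw [map_smul, h, smul_zero]
    · exact Or.inl (map_zero _)

/-- Among three variables of the same arm, weights can be shifted without changing the total weight
or the load, so an arm has at most two positive variables. -/
theorem not_three_pos {x : Fin n → ℕ+ → ℝ} (hx : x ∈ Set.extremePoints ℝ I.feasible)
    {i : Fin n} {a b c : ℕ+} (hab : a ≠ b) (hac : a ≠ c) (hbc : b ≠ c)
    (ha : 0 < x i a) (hb : 0 < x i b) (hc : 0 < x i c) : False := by
  let g : ℕ+ →₀ ℝ := Finsupp.single a (((b : ℕ) : ℝ) - ((c : ℕ) : ℝ)) +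
    Finsupp.single b (((c : ℕ) : ℝ) - ((a : ℕ) : ℝ)) +
    Finsupp.single c (((a : ℕ) : ℝ) - ((b : ℕ) : ℝ))
  have h := I.direction_eq_zero hx (fun l => if l = i then g else 0)
    (fun l τ h => ?_) ?_ (fun l => ?_) i
  · have h' := DFunLike.congr_fun h a
    simp only [if_true, g, Finsupp.add_apply, Finsupp.single_eq_same,
      Finsupp.single_eq_of_ne hab, Finsupp.single_eq_of_ne hac, Finsupp.coe_zero,
      Pi.zero_apply, add_zero, sub_eq_zero, Nat.cast_inj, PNat.coe_inj] at h'
    exact hbc h'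
  · split_ifs at h with h1
    · subst h1
      by_cases h1 : τ = a
      · exact h1 ▸ ha
      by_cases h2 : τ = b
      · exact h2 ▸ hb
      by_cases h3 : τ = c
      · exact h3 ▸ hc
      · exact absurd (by simp [g, h1, h2, h3]) h
    · exact absurd rfl h
  · rw [Finset.sum_eq_single i (fun l _ hl => by rw [if_neg hl, map_zero]) (by simp), if_pos rfl]
    simp only [g, map_add, rowMass_single]
    ring
  · refine Or.inl ?_
    split_ifs
    · simp only [g, map_add, rowLoad_single]
      ring
    · exact map_zero _

/-- The algorithm can be carried out from every extreme point. -/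
theorem nonempty_randomizeThenInterleave {x : Fin n → ℕ+ → ℝ}
    (hx : x ∈ Set.extremePoints ℝ I.feasible) : Nonempty (I.RandomizeThenInterleave x) := by
  classical
  choose play hplay using fun (c : Fin n → Option ℕ+) r => I.exists_isOnlineRun c r
  let crit : Fin n → ℕ+ := fun i =>
    if h : ∃ τ : ℕ+, x i τ = 1 / ((τ : ℕ) : ℝ) then h.choose else 1
  have hcrit : ∀ i, (∃ τ : ℕ+, x i τ = 1 / ((τ : ℕ) : ℝ)) →
      x i (crit i) = 1 / ((crit i : ℕ) : ℝ) := fun i h => by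
    simp only [crit, dif_pos h]
    exact h.choose_spec
  by_cases h : ∃ i, Supported x i ∧ ∀ τ : ℕ+, x i τ ≠ 1 / ((τ : ℕ) : ℝ)
  · obtain ⟨i, ⟨a, ha⟩, hi⟩ := h
    obtain ⟨b, hab, hb⟩ : ∃ b, a ≠ b ∧ ∀ τ, x i τ ≠ 0 → τ = a ∨ τ = b := by
      by_cases h2 : ∃ b, a ≠ b ∧ 0 < x i b
      · obtain ⟨b, hab, hb⟩ := h2
        refine ⟨b, hab, fun τ hτ => ?_⟩
        by_contra! hne
        exact I.not_three_pos hx hab hne.1.symm hne.2.symm ha hb ((hx.1.1 i τ).lt_of_ne' hτ)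
      · push Not at h2
        refine ⟨a + 1, (PNat.lt_add_right a 1).ne, fun τ hτ => Or.inl ?_⟩
        by_contra hne
        exact hτ (le_antisymm (h2 τ (Ne.symm hne)) (hx.1.1 i τ))
    refine ⟨⟨some i, crit, a, b, fun j hj hji => hcrit j ?_, ?_, play, hplay⟩⟩
    · by_contra! hj'
      exact hji (congrArg some (I.irregular_unique hx ⟨a, ha⟩ hi hj hj'))
    · rintro j hj
      obtain rfl : i = j := Option.some.inj hj
      exact ⟨ha, hx.1.1 i b, hab, hb, (I.le_one_div hx.1 i a).lt_of_ne (hi a),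
        (I.le_one_div hx.1 i b).lt_of_ne (hi b)⟩
  · push Not at h
    exact ⟨⟨none, crit, 1, 1, fun j hj _ => hcrit j (h j hj), by simp, play, hplay⟩⟩

end RBInstance

namespace RBInstance

variable {n k : ℕ} (I : RBInstance n k)

/-! ### The payoff of a round for fixed critical delays -/

/-- The probability, over the offset, that arm `i` is a candidate in a given round and its critical
delay has payoff at least `θ`. -/
noncomputable def hitProb (c : Fin n → Option ℕ+) (θ : ℝ) (i : Fin n) : ℝ :=
  (c i).elim 0 fun d => (if θ ≤ I.p i d then 1 else 0) / ((d : ℕ) : ℝ)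

theorem hitProb_antitone (c : Fin n → Option ℕ+) (i : Fin n) :
    Antitone fun θ => I.hitProb c θ i := by
  cases h : c i with
  | none => intro a b _; simp [hitProb, h]
  | some d =>
    intro a b hab
    simp only [hitProb, h, Option.elim_some]
    exact div_le_div_of_nonneg_right (antitone_indicator_le (I.p i d) hab) (Nat.cast_nonneg _)

theorem integral_hitProb (c : Fin n → Option ℕ+) (i : Fin n) :
    ∫ θ in (0 : ℝ)..1, I.hitProb c θ i = (c i).elim 0 fun d => I.p i d / ((d : ℕ) : ℝ) := by
  cases h : c i with
  | none => simp [hitProb, h]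
  | some d =>
    simp only [hitProb, h, Option.elim_some]
    rw [intervalIntegral.integral_div, integral_indicator_le (I.p_nonneg i d) (I.p_le_one i d)]

open Classical in
/-- The candidates whose critical delays have payoff at least `θ`. -/
noncomputable def candidatesAbove (c : Fin n → Option ℕ+) (t : ℕ) (θ : ℝ) (r : Fin n → ℕ) :
    Finset (Fin n) :=
  Finset.univ.filter fun i => ∃ d : ℕ+, c i = some d ∧ t % (d : ℕ) = r i ∧ θ ≤ I.p i d

theorem candidatesAbove_eq (c : Fin n → Option ℕ+) (t : ℕ) (θ : ℝ)
    (r : Fin n → ℕ) : I.candidatesAbove c t θ r =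
      (candidates c r t).filter fun i => θ ≤ (c i).elim 1 (I.p i) := by
  ext i
  simp only [candidatesAbove, candidates, Finset.mem_filter, Finset.mem_univ, true_and]
  cases h : c i with
  | none => simp
  | some d => simp

theorem offsets_nonempty (c : Fin n → Option ℕ+) : (offsets c).Nonempty := by
  refine Fintype.piFinset_nonempty.2 fun i => ?_
  rw [Finset.nonempty_range_iff]
  cases c i with
  | none => simp
  | some d => exact d.ne_zero

/-- In every round the candidates above a threshold form a sum of independent Bernoulli variables,
since `t` is uniformly distributed relative to the offset. -/
theorem expect_min_card (c : Fin n → Option ℕ+) (t : ℕ) (θ : ℝ) :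
    (𝔼 r ∈ offsets c, ((min k (I.candidatesAbove c t θ r).card : ℕ) : ℝ)) =
      bernoulliMean Finset.univ (I.hitProb c θ) fun W => ((min k W.card : ℕ) : ℝ) := by
  classical
  have h := expect_piFinset_filter (fun i => Finset.range ((c i).elim 1 fun d => (d : ℕ)))
    (Fintype.piFinset_nonempty.1 (offsets_nonempty c))
    (fun i b => ∃ d : ℕ+, c i = some d ∧ t % (d : ℕ) = b ∧ θ ≤ I.p i d)
    (fun W => ((min k W.card : ℕ) : ℝ))
  rw [offsets]
  simp only [candidatesAbove]
  have e := h.trans (bernoulliMean_congr (q' := I.hitProb c θ) (fun i _ => ?_) fun _ _ => rfl)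
  -- the two sides differ only in decidability instances
  · convert e
  cases hc : c i with
  | none => simp [hitProb, hc]
  | some d =>
    have hd : t % (d : ℕ) < d := Nat.mod_lt _ d.pos
    simp only [hitProb, hc, Option.elim_some, Finset.card_range]
    congr 1
    by_cases hθ : θ ≤ I.p i d
    · rw [if_pos hθ, ← Nat.cast_one, Nat.cast_inj, Finset.card_eq_one]
      refine ⟨t % (d : ℕ), ?_⟩
      ext b
      simp only [Option.some.injEq, Finset.mem_filter, Finset.mem_range, exists_eq_left',
        Finset.mem_singleton]
      constructor
      · rintro ⟨-, h, -⟩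
        exact h.symm
      · rintro rfl
        exact ⟨hd, rfl, hθ⟩
    · simp [hθ]

theorem candidatesAbove_card_antitone (c : Fin n → Option ℕ+) (t : ℕ) (r : Fin n → ℕ) :
    Antitone fun θ => ((min k (I.candidatesAbove c t θ r).card : ℕ) : ℝ) := by
  intro a b hab
  refine Nat.cast_le.2 (min_le_min_left k (Finset.card_le_card ?_))
  intro i
  simp only [candidatesAbove, Finset.mem_filter, Finset.mem_univ, true_and]
  exact fun ⟨d, h1, h2, h3⟩ => ⟨d, h1, h2, hab.trans h3⟩

theorem bernoulliMean_hitProb_antitone (c : Fin n → Option ℕ+) :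
    Antitone fun θ => bernoulliMean Finset.univ (I.hitProb c θ)
      fun W => ((min k W.card : ℕ) : ℝ) := by
  intro a b hab
  simp only [← I.expect_min_card c 0]
  exact Finset.expect_le_expect fun r _ => I.candidatesAbove_card_antitone c 0 r hab

/-- The payoff collected in a single round. -/
noncomputable def roundPayoff (A : Schedule n) (t : ℕ) : ℝ := ∑ i ∈ A t, I.p i (delay A i t)

theorem integral_candidatesAbove_le {c : Fin n → Option ℕ+} {r : Fin n → ℕ} {A : Schedule n}
    (hA : I.IsOnlineRun c r A) {t : ℕ} (ht : (I.tauMax : ℕ) ≤ t) :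
    ∫ θ in (0 : ℝ)..1, ((min k (I.candidatesAbove c t θ r).card : ℕ) : ℝ) ≤
      I.roundPayoff A t := by
  have hv : ∀ i, 0 ≤ (c i).elim 1 (I.p i) ∧ (c i).elim 1 (I.p i) ≤ 1 := fun i => by
    cases c i with
    | none => simp
    | some d => exact ⟨I.p_nonneg i d, I.p_le_one i d⟩
  obtain ⟨S, hS, hSk, hint⟩ := exists_integral_min_le_sum (fun i => (c i).elim 1 (I.p i))
    (fun i => (hv i).1) (fun i => (hv i).2) k (candidates c r t)
  calc _ = ∫ θ in (0 : ℝ)..1, ((min k ((candidates c r t).filter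
          fun i => θ ≤ (c i).elim 1 (I.p i)).card : ℕ) : ℝ) := by
        simp only [I.candidatesAbove_eq c t _ r]
    _ ≤ ∑ i ∈ S, (c i).elim 1 (I.p i) := hint
    _ ≤ ∑ i ∈ S, I.p i (delay A i t) := by
        refine Finset.sum_le_sum fun i hi => ?_
        have hi' := hS hi
        simp only [candidates, Finset.mem_filter, Finset.mem_univ, true_and] at hi'
        obtain ⟨d, hd, hr⟩ := hi'
        rw [hd]
        exact I.p_le_p_delay hA ht hd hr
    _ ≤ I.roundPayoff A t := (hA t (le_trans I.tauMax.pos ht)).2.2 S hS hSk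

theorem integral_bernoulliMean_le (c : Fin n → Option ℕ+) {play : (Fin n → ℕ) → Schedule n}
    (hplay : ∀ r, I.IsOnlineRun c r (play r)) {t : ℕ} (ht : (I.tauMax : ℕ) ≤ t) :
    ∫ θ in (0 : ℝ)..1, bernoulliMean Finset.univ (I.hitProb c θ)
        (fun W => ((min k W.card : ℕ) : ℝ)) ≤
      𝔼 r ∈ offsets c, I.roundPayoff (play r) t := by
  simp_rw [← I.expect_min_card c t, Finset.expect_eq_sum_div_card]
  rw [intervalIntegral.integral_div, intervalIntegral.integral_finsetSum
    fun r _ => (I.candidatesAbove_card_antitone c t r).intervalIntegrable]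
  exact div_le_div_of_nonneg_right
    (Finset.sum_le_sum fun r _ => I.integral_candidatesAbove_le (hplay r) ht) (Nat.cast_nonneg _)

/-! ### Averaging over the critical delay of the irregular arm -/

namespace RandomizeThenInterleave

variable {I} {x : Fin n → ℕ+ → ℝ} (E : I.RandomizeThenInterleave x)

/-- The possible samples for the irregular arm. Without an irregular arm only `none` has positive
probability. -/
def samples : Finset (Option ℕ+) := {none, some E.a, some E.b}

/-- The distribution of the critical delay sampled for the irregular arm. -/
def sampleProb (s : Option ℕ+) : ℝ :=
  match E.irregular, s with
  | none, none => 1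
  | none, some _ => 0
  | some i, some τ => ((τ : ℕ) : ℝ) * x i τ
  | some i, none => 1 - ((E.a : ℕ) : ℝ) * x i E.a - ((E.b : ℕ) : ℝ) * x i E.b

theorem sum_sampleProb_mul_of_none (h : E.irregular = none) (f : Option ℕ+ → ℝ) :
    ∑ s ∈ E.samples, E.sampleProb s * f s = f none := by
  rw [Finset.sum_eq_single none]
  · simp [sampleProb, h]
  · intro s _ hs
    obtain ⟨τ, rfl⟩ := Option.ne_none_iff_exists'.1 hs
    simp [sampleProb, h]
  · simp [samples]

theorem sum_sampleProb_mul_of_some {i : Fin n} (h : E.irregular = some i) (f : Option ℕ+ → ℝ) :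
    ∑ s ∈ E.samples, E.sampleProb s * f s =
      ((E.a : ℕ) : ℝ) * x i E.a * f (some E.a) + ((E.b : ℕ) : ℝ) * x i E.b * f (some E.b)
        + (1 - ((E.a : ℕ) : ℝ) * x i E.a - ((E.b : ℕ) : ℝ) * x i E.b) * f none := by
  have hab := (E.irregular_spec i h).2.2.1
  rw [samples, Finset.sum_insert (by simp), Finset.sum_pair (by simpa using hab)]
  simp only [sampleProb, h]
  ring

theorem expectedPayoff_eq (T : ℕ) :
    E.expectedPayoff T = ∑ s ∈ E.samples, E.sampleProb s * E.offsetMean s T := by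
  cases h : E.irregular with
  | none => rw [E.sum_sampleProb_mul_of_none h, expectedPayoff, h]
  | some i => rw [E.sum_sampleProb_mul_of_some h, expectedPayoff, h]

theorem sum_sampleProb : ∑ s ∈ E.samples, E.sampleProb s = 1 := by
  cases hi : E.irregular with
  | none => simpa using E.sum_sampleProb_mul_of_none hi fun _ => 1
  | some i =>
    have := E.sum_sampleProb_mul_of_some hi fun _ => 1
    simp only [mul_one] at this
    rw [this]
    ring

theorem sampleProb_nonneg (hx : x ∈ I.feasible) (s : Option ℕ+) : 0 ≤ E.sampleProb s := by
  cases hi : E.irregular with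
  | none => cases s <;> simp [sampleProb, hi]
  | some i =>
    cases s with
    | some τ =>
      simp only [sampleProb, hi]
      exact mul_nonneg (Nat.cast_nonneg _) (hx.1 i τ)
    | none =>
      have h := (hx.2.1 i).sum_le_tsum {E.a, E.b} fun τ _ =>
        mul_nonneg (Nat.cast_nonneg _) (hx.1 i τ)
      rw [Finset.sum_pair (E.irregular_spec i hi).2.2.1] at h
      have := hx.2.2.2 i
      simp only [sampleProb, hi]
      linarith

theorem criticalDelays_eq {i : Fin n} (hi : E.irregular ≠ some i) (s s' : Option ℕ+) :
    E.criticalDelays s i = E.criticalDelays s' i := by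
  simp [criticalDelays, hi]

/-- The probability that arm `i` is a candidate with critical delay `τ` is `x i τ`. -/
theorem sum_sampleProb_mul_elim (hx : x ∈ I.feasible) (i : Fin n) (g : ℕ+ → ℝ) :
    ∑ s ∈ E.samples, E.sampleProb s *
        (E.criticalDelays s i).elim 0 (fun d => g d / ((d : ℕ) : ℝ)) =
      ∑' τ, g τ * x i τ := by
  have hne : ∀ τ : ℕ+, ((τ : ℕ) : ℝ) ≠ 0 := fun τ => Nat.cast_ne_zero.2 τ.ne_zero
  by_cases hi : E.irregular = some i
  · obtain ⟨-, -, hab, hsupp, -, -⟩ := E.irregular_spec i hi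
    rw [E.sum_sampleProb_mul_of_some hi, tsum_eq_sum (s := {E.a, E.b}), Finset.sum_pair hab]
    · simp only [criticalDelays, hi, if_true, Option.elim_some, Option.elim_none, mul_zero,
        add_zero]
      have ha := hne E.a
      have hb := hne E.b
      field_simp
    · intro τ hτ
      rw [not_imp_comm.1 (hsupp τ) (by simpa using hτ), mul_zero]
  · have e : ∀ s, E.criticalDelays s i = E.criticalDelays none i := fun s =>
      E.criticalDelays_eq hi s none
    simp_rw [e]
    rw [← Finset.sum_mul, E.sum_sampleProb, one_mul]
    by_cases hs : Supported x i
    · have hc := E.critical_spec i hs hi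
      rw [tsum_eq_single (E.critical i) fun τ hτ => by
        rw [I.eq_zero_of_eq_one_div hx hc hτ, mul_zero], hc]
      simp [criticalDelays, hi, hs, div_eq_mul_inv]
    · have h0 : ∀ τ, x i τ = 0 := fun τ =>
        le_antisymm (not_lt.1 fun h => hs ⟨τ, h⟩) (hx.1 i τ)
      simp [criticalDelays, hi, hs, h0]

theorem sum_sampleProb_mul_hitProb (hx : x ∈ I.feasible) (θ : ℝ) (i : Fin n) :
    ∑ s ∈ E.samples, E.sampleProb s * I.hitProb (E.criticalDelays s) θ i =
      ∑' τ, (if θ ≤ I.p i τ then 1 else 0) * x i τ :=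
  E.sum_sampleProb_mul_elim hx i fun τ => if θ ≤ I.p i τ then 1 else 0

/-- At each threshold the random critical delay of the irregular arm only averages its probability
of being a candidate, so the bound for sums of Bernoulli variables applies. -/
theorem mul_sum_hitProb_le (hx : x ∈ I.feasible) (θ : ℝ) :
    (1 - poissonWeight k k) *
        ∑ i, ∑ s ∈ E.samples, E.sampleProb s * I.hitProb (E.criticalDelays s) θ i ≤
      ∑ s ∈ E.samples, E.sampleProb s *
        bernoulliMean Finset.univ (I.hitProb (E.criticalDelays s) θ)
          (fun W => ((min k W.card : ℕ) : ℝ)) := by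
  obtain ⟨a, ha⟩ : ∃ a : Fin n, ∀ i ≠ a, E.irregular ≠ some i := by
    cases h : E.irregular with
    | none => exact ⟨⟨0, by have := I.k_lt_n; omega⟩, by simp⟩
    | some a => exact ⟨a, fun i hi h' => hi (Option.some.inj h').symm⟩
  rw [sum_mul_bernoulliMean E.samples E.sampleProb E.sum_sampleProb Finset.univ
    (fun s => I.hitProb (E.criticalDelays s) θ) (Finset.mem_univ a) fun i hi s s' => by
      simp only [hitProb, E.criticalDelays_eq (ha i hi) s s']]
  have hle : ∀ i τ, (if θ ≤ I.p i τ then 1 else 0) * x i τ ≤ x i τ := fun i τ => by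
    have := hx.1 i τ
    split_ifs <;> simp [this]
  have h0 : ∀ i τ, 0 ≤ (if θ ≤ I.p i τ then 1 else 0) * x i τ := fun i τ => by
    have := hx.1 i τ
    split_ifs <;> simp [this]
  have htsum : ∀ i, ∑' τ, (if θ ≤ I.p i τ then 1 else 0) * x i τ ≤ ∑' τ, x i τ := fun i =>
    ((I.summable_of_feasible hx i).of_nonneg_of_le (h0 i) (hle i)).tsum_le_tsum (hle i)
      (I.summable_of_feasible hx i)
  have hone : ∀ i, ∑' τ, x i τ ≤ 1 := fun i =>
    ((I.summable_of_feasible hx i).tsum_le_tsum (fun τ =>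
      le_mul_of_one_le_left (hx.1 i τ) (Nat.one_le_cast.2 τ.pos)) (hx.2.1 i)).trans (hx.2.2.2 i)
  refine le_bernoulliMean_min (fun i _ => ?_) (fun i _ => ?_) I.one_le_k ?_
  · rw [E.sum_sampleProb_mul_hitProb hx]
    exact tsum_nonneg (h0 i)
  · rw [E.sum_sampleProb_mul_hitProb hx]
    exact (htsum i).trans (hone i)
  · simp_rw [E.sum_sampleProb_mul_hitProb hx]
    exact (Finset.sum_le_sum fun i _ => htsum i).trans hx.2.2.1

/-- The expected payoff of each round from `tauMax` on. -/
theorem mul_lpValue_le_round (hx : x ∈ I.feasible) {t : ℕ} (ht : (I.tauMax : ℕ) ≤ t) :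
    (1 - poissonWeight k k) * I.lpValue x ≤
      ∑ s ∈ E.samples, E.sampleProb s *
        𝔼 r ∈ offsets (E.criticalDelays s),
          I.roundPayoff (E.play (E.criticalDelays s) r) t := by
  have hint : ∀ s, IntervalIntegrable (fun θ => bernoulliMean Finset.univ
      (I.hitProb (E.criticalDelays s) θ) (fun W => ((min k W.card : ℕ) : ℝ)))
      MeasureTheory.volume 0 1 := fun s =>
    (I.bernoulliMean_hitProb_antitone (E.criticalDelays s)).intervalIntegrable
  have hint' : ∀ i s, IntervalIntegrable
      (fun θ => E.sampleProb s * I.hitProb (E.criticalDelays s) θ i)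
      MeasureTheory.volume 0 1 := fun i s =>
    (I.hitProb_antitone (E.criticalDelays s) i).intervalIntegrable.const_mul _
  have hlp : I.lpValue x = ∫ θ in (0 : ℝ)..1,
      ∑ i, ∑ s ∈ E.samples, E.sampleProb s * I.hitProb (E.criticalDelays s) θ i := by
    rw [intervalIntegral.integral_finsetSum fun i _ => by
      simpa only [Finset.sum_fn] using IntervalIntegrable.sum _ fun s _ => hint' i s]
    refine Finset.sum_congr rfl fun i _ => ?_
    rw [intervalIntegral.integral_finsetSum fun s _ => hint' i s]
    simp_rw [intervalIntegral.integral_const_mul, I.integral_hitProb]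
    exact (E.sum_sampleProb_mul_elim hx i (I.p i)).symm
  calc _ = ∫ θ in (0 : ℝ)..1, (1 - poissonWeight k k) *
        ∑ i, ∑ s ∈ E.samples, E.sampleProb s * I.hitProb (E.criticalDelays s) θ i := by
        rw [intervalIntegral.integral_const_mul, ← hlp]
    _ ≤ ∫ θ in (0 : ℝ)..1, ∑ s ∈ E.samples, E.sampleProb s *
        bernoulliMean Finset.univ (I.hitProb (E.criticalDelays s) θ)
          (fun W => ((min k W.card : ℕ) : ℝ)) := by
        refine intervalIntegral.integral_mono_on zero_le_one ?_ ?_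
          fun θ _ => E.mul_sum_hitProb_le hx θ
        · refine IntervalIntegrable.const_mul ?_ _
          simpa only [Finset.sum_fn] using IntervalIntegrable.sum _ fun i _ =>
            IntervalIntegrable.sum _ fun s _ => hint' i s
        · simpa only [Finset.sum_fn] using
            IntervalIntegrable.sum _ fun s _ => (hint s).const_mul (E.sampleProb s)
    _ = ∑ s ∈ E.samples, E.sampleProb s * ∫ θ in (0 : ℝ)..1,
        bernoulliMean Finset.univ (I.hitProb (E.criticalDelays s) θ)
          (fun W => ((min k W.card : ℕ) : ℝ)) := by
        rw [intervalIntegral.integral_finsetSum fun s _ => (hint s).const_mul _]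
        simp_rw [intervalIntegral.integral_const_mul]
    _ ≤ _ := Finset.sum_le_sum fun s _ => mul_le_mul_of_nonneg_left
        (I.integral_bernoulliMean_le _ (E.play_spec _) ht) (E.sampleProb_nonneg hx s)

theorem expectedPayoff_eq_sum_round (T : ℕ) :
    E.expectedPayoff T = ∑ t ∈ Finset.Icc 1 T, ∑ s ∈ E.samples, E.sampleProb s *
      𝔼 r ∈ offsets (E.criticalDelays s), I.roundPayoff (E.play (E.criticalDelays s) r) t := by
  rw [E.expectedPayoff_eq, Finset.sum_comm]
  refine Finset.sum_congr rfl fun s _ => ?_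
  rw [← Finset.mul_sum, offsetMean, ← Finset.expect_sum_comm]
  rfl

theorem round_nonneg (hx : x ∈ I.feasible) (t : ℕ) :
    0 ≤ ∑ s ∈ E.samples, E.sampleProb s *
      𝔼 r ∈ offsets (E.criticalDelays s), I.roundPayoff (E.play (E.criticalDelays s) r) t :=
  Finset.sum_nonneg fun s _ => mul_nonneg (E.sampleProb_nonneg hx s) <|
    Finset.expect_nonneg fun _ _ => Finset.sum_nonneg fun _ _ => I.p_nonneg _ _

theorem expectedPayoff_nonneg (hx : x ∈ I.feasible) (T : ℕ) : 0 ≤ E.expectedPayoff T := by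
  rw [E.expectedPayoff_eq_sum_round]
  exact Finset.sum_nonneg fun t _ => E.round_nonneg hx t

/-- Only the rounds before `tauMax` can fall short, each by at most `k`. -/
theorem mul_lpValue_sub_le_expectedPayoff (hx : x ∈ I.feasible) (T : ℕ) :
    (1 - poissonWeight k k) * (T * I.lpValue x) - k * ((I.tauMax : ℕ) : ℝ) ≤
      E.expectedPayoff T := by
  have hB : (1 - poissonWeight k k) * I.lpValue x ≤ k := by
    have := mul_nonneg (poissonWeight_nonneg k (Nat.cast_nonneg k)) (I.lpValue_nonneg hx)
    have := I.lpValue_le hx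
    linarith
  have hcard : ((Finset.Icc 1 T).filter fun t => t < (I.tauMax : ℕ)).card ≤ (I.tauMax : ℕ) := by
    refine (Finset.card_le_card (t := Finset.range (I.tauMax : ℕ)) fun t ht => ?_).trans_eq
      (Finset.card_range _)
    exact Finset.mem_range.2 (Finset.mem_filter.1 ht).2
  rw [E.expectedPayoff_eq_sum_round]
  calc _ ≤ ∑ t ∈ Finset.Icc 1 T, ((1 - poissonWeight k k) * I.lpValue x -
        if t < (I.tauMax : ℕ) then (k : ℝ) else 0) := by
        rw [Finset.sum_sub_distrib, Finset.sum_const, Nat.card_Icc, Nat.add_sub_cancel,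
          ← Finset.sum_filter, Finset.sum_const, nsmul_eq_mul, nsmul_eq_mul]
        have : (((Finset.Icc 1 T).filter fun t => t < (I.tauMax : ℕ)).card : ℝ) * k ≤
            (I.tauMax : ℕ) * k :=
          mul_le_mul_of_nonneg_right (Nat.cast_le.2 hcard) (Nat.cast_nonneg k)
        linarith
    _ ≤ _ := by
        refine Finset.sum_le_sum fun t _ => ?_
        split_ifs with h
        · exact (sub_nonpos.2 hB).trans (E.round_nonneg hx t)
        · rw [sub_zero]
          exact E.mul_lpValue_le_round hx (not_lt.1 h)

end RandomizeThenInterleave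

end RBInstance

/-! ### The guarantee and its asymptotics -/

theorem poissonWeight_self_le_one (k : ℕ) : poissonWeight k k ≤ 1 := by
  rw [poissonWeight, Real.exp_neg, inv_mul_le_one₀ (Real.exp_pos _)]
  exact Real.pow_div_factorial_le_exp _ (Nat.cast_nonneg k) k

theorem pow_self_div_factorial_isEquivalent :
    (fun k : ℕ => (k : ℝ) ^ k / (Real.exp 1 ^ k * (k ! : ℝ))) ~[atTop]
      (fun k : ℕ => 1 / √(2 * Real.pi * (k : ℝ))) := by
  have h := (IsEquivalent.refl (u := fun k : ℕ => (k : ℝ) ^ k / Real.exp 1 ^ k) (l := atTop)).div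
    Stirling.factorial_isEquivalent_stirling
  refine (h.congr_left ?_).congr_right ?_
  · exact Eventually.of_forall fun k => by simp [div_div]
  · filter_upwards [eventually_ge_atTop 1] with k hk
    have hk' : (0 : ℝ) < k := by exact_mod_cast hk
    have h1 : (k / Real.exp 1 : ℝ) ^ k ≠ 0 := by positivity
    simp only [Pi.div_apply]
    rw [← div_pow, mul_right_comm, mul_comm, div_mul_cancel_left₀ h1, one_div]

theorem theorem1 :
    (∃ C : ℝ, ∀ (n k : ℕ) (I : RBInstance n k),
      (∃ x, I.IsOptimalExtremePoint x) ∧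
      ∀ x, I.IsOptimalExtremePoint x →
        Nonempty (I.RandomizeThenInterleave x) ∧
        ∀ (E : I.RandomizeThenInterleave x) (T : ℕ),
          (1 - (k : ℝ) ^ k / (Real.exp 1 ^ k * (k ! : ℝ))) * I.opt T
              - C * ((k : ℝ) * ((I.tauMax : ℕ) : ℝ))
            ≤ E.expectedPayoff T) ∧
    (fun k : ℕ => (k : ℝ) ^ k / (Real.exp 1 ^ k * (k ! : ℝ))) ~[atTop]
      (fun k : ℕ => 1 / √(2 * Real.pi * (k : ℝ))) ∧
    (∀ (n : ℕ) (I : RBInstance n 1) (x : Fin n → ℕ+ → ℝ), I.IsOptimalExtremePoint x →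
      ∀ (E : I.RandomizeThenInterleave x) (ε : ℝ), 0 < ε →
        ∀ᶠ T : ℕ in atTop,
          (1 - 1 / Real.exp 1 - ε) * I.opt T ≤ E.expectedPayoff T) := by
  refine ⟨⟨1, fun n k I => ⟨I.exists_isOptimalExtremePoint, fun x hx =>
    ⟨I.nonempty_randomizeThenInterleave hx.1, fun E T => ?_⟩⟩⟩,
    pow_self_div_factorial_isEquivalent, fun n I x hx E ε hε => ?_⟩
  · have h1 := E.mul_lpValue_sub_le_expectedPayoff hx.1.1 T
    have h2 := mul_le_mul_of_nonneg_left (I.opt_le hx T)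
      (sub_nonneg.2 (poissonWeight_self_le_one k))
    rw [← poissonWeight_self]
    linarith
  · have hδ : poissonWeight 1 (1 : ℕ) = 1 / Real.exp 1 := by
      rw [poissonWeight_self]; simp
    have hlp := I.lpValue_nonneg hx.1.1
    -- the loss of `tauMax` is absorbed by `ε T` times the LP value once `T` is large
    obtain ⟨N, hN⟩ : ∃ N : ℕ, 0 < I.lpValue x → ((I.tauMax : ℕ) : ℝ) ≤ N * (ε * I.lpValue x) := by
      obtain ⟨N, hN⟩ := exists_nat_ge (((I.tauMax : ℕ) : ℝ) / (ε * I.lpValue x))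
      exact ⟨N, fun h => (div_le_iff₀ (by positivity)).1 hN⟩
    filter_upwards [eventually_ge_atTop N] with T hT
    have hopt := I.opt_le hx T
    have hopt0 := I.opt_nonneg T
    have hE0 := E.expectedPayoff_nonneg hx.1.1 T
    have hE := E.mul_lpValue_sub_le_expectedPayoff hx.1.1 T
    rw [hδ, Nat.cast_one, one_mul] at hE
    rcases hlp.eq_or_lt with h0 | hpos
    · rw [← h0, mul_zero] at hopt
      rw [le_antisymm hopt hopt0, mul_zero]
      exact hE0
    rcases le_total (1 - 1 / Real.exp 1 - ε) 0 with hneg | hge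
    · exact (mul_nonpos_of_nonpos_of_nonneg hneg hopt0).trans hE0
    · have h1 := mul_le_mul_of_nonneg_left hopt hge
      have h2 : (N : ℝ) * (ε * I.lpValue x) ≤ T * (ε * I.lpValue x) :=
        mul_le_mul_of_nonneg_right (Nat.cast_le.2 hT) (by positivity)
      have h3 := hN hpos
      linarith
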